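/- Fix $\beta>1/2$, $C>0$, $\mu\in\mathbb R$, $\sigma>0$, and integers $r_{j,n}\ge 1$ for $n\ge 1$, $1\le j\le n$. For every $n$ one observes $Y_{j,k}=X_j+\varepsilon_{j,k}$, $1\le j\le n$, $1\le k\le r_{j,n}$, where all the variables $X_j$, $\varepsilon_{j,k}$ are independent, each $X_j$ has the unknown density $f_X$, and each $\varepsilon_{j,k}$ is $N(\mu,\sigma^2)$-distributed. Put $\bar Y_j=r_{j,n}^{-1}\sum_{k=1}^{r_{j,n}}Y_{j,k}$, let $f_{\varepsilon_j}$ be the density of the averaged error $r_{j,n}^{-1}\sum_{k}\varepsilon_{j,k}$, that is, of $N(\mu,\sigma_{j,n}^2)$ with $\sigma_{j,n}^2=\sigma^2/r_{j,n}$, and write $g^{\mathrm{ft}}(t)=\int e^{itx}g(x)\,dx$ (in the $L_2$ sense for $g\in L_2(\mathbb R)$). Let $\mathcal F_{\beta,C}$ be the set of probability densities $f$ on $\mathbb R$ with $\int|f^{\mathrm{ft}}(t)|^2(1+t^2)^\beta\,dt\le C$. For a kernel $K$ and smoothing parameters $\omega_n>0$ consider the estimator $$\hat f_n(x)=\frac1{2\pi}\int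 e^{-itx}K^{\mathrm{ft}}(t/\omega_n)\,\frac{\sum_{j=1}^n f_{\varepsilon_j}^{\mathrm{ft}}(-t)\,e^{it\bar Y_j}}{\sum_{k=1}^n|f_{\varepsilon_k}^{\mathrm{ft}}(t)|^2}\,dt,\qquad \mathrm{MISE}_n(f_X)=\mathbb E\|\hat f_n-f_X\|_{L_2(\mathbb R)}^2 .$$ The admissible kernels are the square-integrable $K:\mathbb R\to\mathbb R$ for which (a version of) $K^{\mathrm{ft}}$ satisfies: $K^{\mathrm{ft}}$ is continuous at $0$ with $K^{\mathrm{ft}}(0)=1$, $|K^{\mathrm{ft}}|\le1$, $K^{\mathrm{ft}}(t)=0$ for $|t|>1$, $|K^{\mathrm{ft}}(t)-1|=o(|t|^\beta)$ as $t\to0$, and $t\mapsto f_{\varepsilon_j}^{\mathrm{ft}}(t\omega_n)K^{\mathrm{ft}}(t)/\sum_{k=1}^n|f_{\varepsilon_k}^{\mathrm{ft}}(t\omega_n)|^2$ belongs to $L_2(\mathbb R)$ for all $n\ge1$ and $1\le j\le n$. **Theorem 3.2.** The following are equivalent: 1. Algebraic rates can be obtained: there are an admissible kernel $K$, smoothing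 parameters $\omega_n>0$ and a $\kappa>0$ such that $\sup_{f_X\in\mathcal F_{\beta,C}}\mathrm{MISE}_n(f_X)=O(n^{-\kappa})$ as $n\to\infty$. 2. There are $\alpha,\gamma,c,\delta>0$ such that $$\#\{j\in\{1,\dots,n\}:\ \sigma_{j,n}^2<\gamma\, n^{-\alpha}\ln n\}\ \ge\ c\,n^\delta\qquad\text{for all } n\ge 2 .$$ -/

import Mathlib

open MeasureTheory ProbabilityTheory Filter Topology Asymptotics FourierTransform
open scoped ENNReal NNReal

namespace Deconvolution

noncomputable section

/-! ### Densities, Fourier transforms, the Sobolev class -/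

/-- `f` is a probability density on the real line. -/
structure IsDensity (f : ℝ → ℝ) : Prop where
  measurable : Measurable f
  nonneg : ∀ x, 0 ≤ f x
  lintegral_eq_one : ∫⁻ x, ENNReal.ofReal (f x) = 1

/-- The probability law on the real line with density `f`. -/
def densityLaw (f : ℝ → ℝ) : Measure ℝ :=
  volume.withDensity fun x => ENNReal.ofReal (f x)

/-- The Fourier transform `f^ft(t) = ∫ exp(itx) f(x) dx` of an integrable function.
For a probability law the same convention is Mathlib's `charFun`. -/
def ft (f : ℝ → ℝ) (t : ℝ) : ℂ :=
  ∫ x : ℝ, Complex.exp (Complex.I * t * x) * (f x : ℂ)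

/-- The class of densities `f` with `∫ |f^ft(t)|² (1 + t²)^β dt ≤ C`. -/
def sobolevClass (β C : ℝ) : Set (ℝ → ℝ) :=
  {f | IsDensity f ∧
    ∫⁻ t : ℝ, ENNReal.ofReal (‖ft f t‖ ^ 2 * (1 + t ^ 2) ^ β) ≤ ENNReal.ofReal C}

/-! ### The model with replicated measurements -/

/-- The sample space: the variables `X_j` together with the errors `ε_{j,k}`, where
`j` ranges over `n` individuals and `k` over the `r j` replicates of individual `j`. -/
abbrev SampleSpace {n : ℕ} (r : Fin n → ℕ) : Type :=
  (Fin n → ℝ) × ((j : Fin n) → Fin (r j) → ℝ)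

/-- The joint law of the `X_j` and the `ε_{j,k}`: all of them are independent, each `X_j` has
density `f` and each `ε_{j,k}` has law `ν`. -/
def modelLaw (f : ℝ → ℝ) (ν : Measure ℝ) {n : ℕ} (r : Fin n → ℕ) : Measure (SampleSpace r) :=
  (Measure.pi fun _ : Fin n => densityLaw f).prod
    (Measure.pi fun j : Fin n => Measure.pi fun _ : Fin (r j) => ν)

/-- The observation `Y_{j,k} = X_j + ε_{j,k}`. -/
def observation {n : ℕ} {r : Fin n → ℕ} (p : SampleSpace r) (j : Fin n) (k : Fin (r j)) : ℝ :=
  p.1 j + p.2 j k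

/-- The average of the observations of individual `j`. -/
def averagedSample {n : ℕ} {r : Fin n → ℕ} (p : SampleSpace r) (j : Fin n) : ℝ :=
  (∑ k : Fin (r j), observation p j k) / (r j : ℝ)

/-- The law of the average of `m` independent errors with law `ν`. -/
def avgErrorLaw (ν : Measure ℝ) (m : ℕ) : Measure ℝ :=
  (Measure.pi fun _ : Fin m => ν).map fun e => (∑ k : Fin m, e k) / (m : ℝ)

/-- The characteristic functions `f_{ε_j}^ft` of the averaged errors. -/
def avgErrorFT (ν : Measure ℝ) {n : ℕ} (r : Fin n → ℕ) (j : Fin n) : ℝ → ℂ :=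
  charFun (avgErrorLaw ν (r j))

/-! ### The heteroscedastic deconvolution kernel estimator

Below, `g j` is the characteristic function of the `j`-th error, `φ` is the Fourier transform
of the kernel and `w` is the smoothing parameter. -/

/-- `Ψ_n(t) = ∑_j g_j(-t) exp(i t y_j) / ∑_k |g_k(t)|²`. -/
def Psi {n : ℕ} (g : Fin n → ℝ → ℂ) (y : Fin n → ℝ) (t : ℝ) : ℂ :=
  (∑ j, g j (-t) * Complex.exp (Complex.I * t * y j)) / ((∑ k, ‖g k t‖ ^ 2 : ℝ) : ℂ)

/-- The estimator `(2π)⁻¹ ∫ exp(-itx) φ(t/w) Ψ_n(t) dt`, evaluated at the sample `y`. -/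
def estimator (φ : ℝ → ℂ) (w : ℝ) {n : ℕ} (g : Fin n → ℝ → ℂ) (y : Fin n → ℝ) (x : ℝ) : ℂ :=
  (1 / (2 * (Real.pi : ℂ))) *
    ∫ t : ℝ, Complex.exp (-(Complex.I * t * x)) * φ (t / w) * Psi g y t

/-- The mean integrated squared error `E ‖f̂_n - f‖²_{L²(ℝ)}` of the estimator applied to the
averaged observations, as an extended nonnegative real number. -/
def mise (φ : ℝ → ℂ) (w : ℝ) (f : ℝ → ℝ) (ν : Measure ℝ) {n : ℕ} (r : Fin n → ℕ) : ℝ≥0∞ :=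
  ∫⁻ p, (∫⁻ x : ℝ, ENNReal.ofReal
    (‖estimator φ w (avgErrorFT ν r) (averagedSample p) x - (f x : ℂ)‖ ^ 2)) ∂(modelLaw f ν r)

/-- The supremum of the mean integrated squared error over the Sobolev class. -/
def supMise (β C : ℝ) (φ : ℝ → ℂ) (w : ℝ) (ν : Measure ℝ) {n : ℕ} (r : Fin n → ℕ) : ℝ≥0∞ :=
  ⨆ f ∈ sobolevClass β C, mise φ w f ν r

/-! ### Conditions on the kernel -/

/-- `K` is a square-integrable kernel and `φ` is (a version of) its Fourier transform
`K^ft(t) = ∫ exp(itx) K(x) dx`, taken in `L²`. Mathlib's transform `𝓕` has the factor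
`exp(-2πixξ)`, so that `𝓕 K ξ = K^ft(-2πξ)`. -/
def IsKernelWithFT (K : ℝ → ℝ) (φ : ℝ → ℂ) : Prop :=
  ∃ hK : MemLp (fun x => (K x : ℂ)) 2 (volume : Measure ℝ),
    (fun ξ : ℝ => φ (-(2 * Real.pi * ξ))) =ᵐ[volume] (𝓕 (hK.toLp _) : Lp ℂ 2 (volume : Measure ℝ))

/-- The conditions under which the estimator is well defined. -/
structure ConditionA {n : ℕ} (g : Fin n → ℝ → ℂ) (φ : ℝ → ℂ) (w : ℝ) : Prop where
  exists_ne_zero : ∃ j, ∀ t, g j t ≠ 0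
  bounded : ∃ M : ℝ, ∀ t, ‖φ t‖ ≤ M
  continuousAt : ContinuousAt φ 0
  map_zero : φ 0 = 1
  memLp : ∀ j, MemLp (fun t : ℝ => g j (t * w) * φ t / ((∑ k, ‖g k (t * w)‖ ^ 2 : ℝ) : ℂ)) 2
    (volume : Measure ℝ)

/-- The regularity conditions on the Fourier transform of the kernel:
`|φ| ≤ 1`, `φ` is supported on `[-1, 1]`, and `|φ(t) - 1| = o(|t|^β)` as `t → 0`. -/
structure ConditionB (β : ℝ) (φ : ℝ → ℂ) : Prop where
  norm_le_one : ∀ t, ‖φ t‖ ≤ 1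
  support : ∀ t, 1 < |t| → φ t = 0
  order : (fun t : ℝ => φ t - 1) =o[𝓝 0] fun t : ℝ => |t| ^ β

/-! ### Algebraic rates -/

/-- `a n = O(n^{-κ})` for some `κ > 0`. -/
def HasAlgebraicRate (a : ℕ → ℝ≥0∞) : Prop :=
  ∃ κ : ℝ, 0 < κ ∧ ∃ A : ℝ, ∀ᶠ n : ℕ in atTop, a n ≤ ENNReal.ofReal (A * (n : ℝ) ^ (-κ))

/-- For some kernel and some choice of the smoothing parameters, satisfying the conditions above,
the supremum over the Sobolev class of the mean integrated squared error of the estimator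
converges to zero at an algebraic rate. Here `r n j` is the number of replicates of
individual `j` in the sample with `n` individuals. -/
def AlgebraicRatesAttainable (β C : ℝ) (ν : Measure ℝ) (r : (n : ℕ) → Fin n → ℕ) : Prop :=
  ∃ (K : ℝ → ℝ) (φ : ℝ → ℂ) (w : ℕ → ℝ),
    IsKernelWithFT K φ ∧ ConditionB β φ ∧ (∀ n, 0 < w n) ∧
    (∀ n, 1 ≤ n → ConditionA (avgErrorFT ν (r n)) φ (w n)) ∧
    HasAlgebraicRate fun n => supMise β C φ (w n) ν (r n)

/-- `J_{n,γ,α}`, the set of those `j` with `σ_{j,n}² < γ n^{-α} ln n`, where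
`σ_{j,n}² = σ² / r_{j,n}`. -/
def smallVarianceSet (σ : ℝ≥0) (r : (n : ℕ) → Fin n → ℕ) (n : ℕ) (γ α : ℝ) : Set (Fin n) :=
  {j | (σ : ℝ) ^ 2 / (r n j : ℝ) < γ * (n : ℝ) ^ (-α) * Real.log n}

end

end Deconvolution

/-! ### Fourier inversion and Plancherel on L¹ ∩ L². -/

section FourierLTwo

open SchwartzMap

/-! Write `S(t)` for the sum of the `exp(-σ_j² t²)`, that is `errorEnergy`, and `φ` for the
transform of the kernel. By Parseval, Tonelli and independence (`mise_eq_lintegral`) the risk is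
`1/(2π)` times the integral of a variance term plus the squared bias `|φ(t/w) - 1|² |f^ft|²`. The
variance term lies between `|φ(t/w)|² (1 - |f^ft|²) / S(t)` and `|φ(t/w)|² / S(t)`, so everything
depends on the size of `S` on the band `|t| ≤ w`.

If there are many small variances, take the sinc kernel and `w = n^a` with `a` small. For the good
indices `σ_j² w²` stays bounded, hence `S(w)` is at least a constant times `n^δ`. The variance is
then `O(n^(a-δ))` and the bias `O(n^(-2aβ))`; see `supMise_sincFT_le` and
`card_mul_exp_le_errorEnergy`.

Conversely, test a rate `n^(-κ)` on a single Gamma density of the class, whose transform decays only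
polynomially. Frequencies beyond `w` are lost, so the bias forces `w²` to be at least a constant
times `n^α` for some `α > 0` (`bias_le_supMise`). The variance on a part of the band where `φ` is
close to 1 forces `S` to be at least of order `n^κ` at a frequency proportional to `w`
(`variance_le_supMise`). There an index with `σ_j² ≥ γ n^(-α) ln n` contributes at most `1/n` when
`γ` is suitable, so all of these together contribute at most 1 and the others must number at least a
constant times `n^κ` (`errorEnergy_le_card_add_one`). -/

theorem integral_schwartz_mul_fourierInv (G : 𝓢(ℝ, ℂ)) {h : ℝ → ℂ} (hh : Integrable h) :
    ∫ x, G x * 𝓕⁻ h x = ∫ x, 𝓕⁻ (G : ℝ → ℂ) x * h x := by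
  have := VectorFourier.integral_fourierIntegral_smul_eq_flip (e := Real.fourierChar)
    (μ := volume) (ν := volume) (L := -innerₗ ℝ) (f := (G : ℝ → ℂ)) (g := h)
    Real.continuous_fourierChar (by simpa using by fun_prop) G.integrable hh
  have e : (-innerₗ ℝ : ℝ →ₗ[ℝ] ℝ →ₗ[ℝ] ℝ).flip = -innerₗ ℝ := by
    ext; simp
  rw [e] at this
  exact this.symm

theorem integral_schwartz_mul_fourier (G : 𝓢(ℝ, ℂ)) {h : ℝ → ℂ} (hh : Integrable h) :
    ∫ x, G x * 𝓕 h x = ∫ x, 𝓕 (G : ℝ → ℂ) x * h x := by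
  have := VectorFourier.integral_fourierIntegral_smul_eq_flip (e := Real.fourierChar)
    (μ := volume) (ν := volume) (L := innerₗ ℝ) (f := (G : ℝ → ℂ)) (g := h)
    Real.continuous_fourierChar (by simpa using by fun_prop) G.integrable hh
  rw [flip_innerₗ] at this
  exact this.symm

/-- Smooth compactly supported functions are Schwartz and already separate locally integrable
functions. This lets identities between transforms be proved by moving the transform onto the test
function. -/
theorem ae_eq_of_integral_schwartz_mul_eq {u v : ℝ → ℂ} (hu : LocallyIntegrable u)
    (hv : LocallyIntegrable v) (h : ∀ G : 𝓢(ℝ, ℂ), ∫ x, G x * u x = ∫ x, G x * v x) :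
    u =ᵐ[volume] v := by
  refine ae_eq_of_integral_contDiff_smul_eq hu hv fun g hg hc => ?_
  have h1 : HasCompactSupport (Complex.ofRealCLM ∘ g) := hc.comp_left rfl
  have h2 : ContDiff ℝ (⊤ : ℕ∞) (Complex.ofRealCLM ∘ g) := by fun_prop
  simpa using h (h1.toSchwartzMap h2)

theorem continuous_fourierInv {h : ℝ → ℂ} (hh : Integrable h) : Continuous (𝓕⁻ h) :=
  VectorFourier.fourierIntegral_continuous (L := -innerₗ ℝ) Real.continuous_fourierChar
    (by simpa using by fun_prop) hh

/-- Fourier inversion almost everywhere. -/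
theorem fourierInv_fourier_ae_eq {f : ℝ → ℂ} (hf : Integrable f) (hf' : Integrable (𝓕 f)) :
    𝓕⁻ (𝓕 f) =ᵐ[volume] f := by
  refine ae_eq_of_integral_schwartz_mul_eq (continuous_fourierInv hf').locallyIntegrable
    hf.locallyIntegrable fun G => ?_
  rw [integral_schwartz_mul_fourierInv G hf', ← SchwartzMap.fourierInv_coe,
    integral_schwartz_mul_fourier _ hf, ← SchwartzMap.fourier_coe, fourier_fourierInv_eq]

/-- On `L¹ ∩ L²` the integral transform agrees with the `L²` transform. -/
theorem fourierInv_toLp_ae_eq {h : ℝ → ℂ} (hh : Integrable h) (hh2 : MemLp h 2) :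
    𝓕⁻ h =ᵐ[volume] (𝓕⁻ (hh2.toLp h) : Lp ℂ 2 (volume : Measure ℝ)) := by
  refine ae_eq_of_integral_schwartz_mul_eq (continuous_fourierInv hh).locallyIntegrable
    ((Lp.memLp _).locallyIntegrable (by norm_num)) fun G => ?_
  have h1 := congrArg (fun T => T G) (Lp.fourierInv_toTemperedDistribution_eq (hh2.toLp h))
  simp only [Lp.toTemperedDistribution_apply, TemperedDistribution.fourierInv_apply,
    smul_eq_mul] at h1
  rw [← h1, integral_schwartz_mul_fourierInv G hh, ← SchwartzMap.fourierInv_coe]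
  refine integral_congr_ae ?_
  filter_upwards [hh2.coeFn_toLp] with x hx
  rw [hx]

/-- Plancherel's identity on `L¹ ∩ L²`. -/
theorem lintegral_norm_fourierInv_sq {h : ℝ → ℂ} (hh : Integrable h) (hh2 : MemLp h 2) :
    ∫⁻ x, ENNReal.ofReal (‖𝓕⁻ h x‖ ^ 2) = ∫⁻ x, ENNReal.ofReal (‖h x‖ ^ 2) := by
  have key : ∀ u : ℝ → ℂ, ∫⁻ x, ENNReal.ofReal (‖u x‖ ^ 2) = eLpNorm u 2 volume ^ 2 := by
    intro u
    have := eLpNorm_nnreal_pow_eq_lintegral (f := u) (μ := volume) (p := 2) (by norm_num)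
    simp only [NNReal.coe_ofNat, ENNReal.coe_ofNat, ENNReal.rpow_ofNat] at this
    rw [this]
    refine lintegral_congr fun x => ?_
    rw [ENNReal.ofReal_pow (norm_nonneg _), ofReal_norm]
  rw [key, key, eLpNorm_congr_ae (fourierInv_toLp_ae_eq hh hh2),
    ← eLpNorm_congr_ae hh2.coeFn_toLp]
  have h1 : ‖(𝓕⁻ (hh2.toLp h) : Lp ℂ 2 (volume : Measure ℝ))‖ₑ = ‖hh2.toLp h‖ₑ := by
    rw [← ofReal_norm, ← ofReal_norm]
    congr 1
    exact (Lp.fourierTransformₗᵢ ℝ ℂ).symm.norm_map _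
  rw [Lp.enorm_def, Lp.enorm_def] at h1
  rw [h1]

end FourierLTwo

/-! ### Passage between the conventions `exp(itx)` and `exp(-2πixξ)`, via `t = -2πξ`. -/

namespace Deconvolution

theorem fourier_eq_ft (f : ℝ → ℝ) (ξ : ℝ) :
    𝓕 (fun x => (f x : ℂ)) ξ = ft f (-(2 * Real.pi * ξ)) := by
  rw [Real.fourier_eq', ft]
  refine integral_congr_ae (ae_of_all _ fun x => ?_)
  simp only [smul_eq_mul, RCLike.inner_apply, conj_trivial]
  congr 2
  push_cast
  ring

theorem lintegral_comp_neg_two_pi_mul (u : ℝ → ℝ≥0∞) :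
    ∫⁻ ξ : ℝ, u (-(2 * Real.pi * ξ)) = ENNReal.ofReal (1 / (2 * Real.pi)) * ∫⁻ t, u t := by
  have h0 : (-(2 * Real.pi)) ≠ 0 := by simp [Real.pi_ne_zero]
  have h1 := Real.map_volume_mul_left h0
  have h2 := lintegral_map_equiv (μ := volume) u (Homeomorph.mulLeft₀ _ h0).toMeasurableEquiv
  have h3 : Measure.map ((Homeomorph.mulLeft₀ _ h0).toMeasurableEquiv) volume
      = ENNReal.ofReal |(-(2 * Real.pi))⁻¹| • (volume : Measure ℝ) := h1
  rw [h3, lintegral_smul_measure, smul_eq_mul] at h2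
  have e : |(-(2 * Real.pi))⁻¹| = 1 / (2 * Real.pi) := by
    rw [abs_inv, abs_neg, abs_of_pos (by positivity), one_div]
  rw [e] at h2
  rw [h2]
  refine lintegral_congr fun ξ => ?_
  simp

theorem quasiMeasurePreserving_neg_two_pi_mul :
    Measure.QuasiMeasurePreserving (fun ξ : ℝ => -(2 * Real.pi * ξ)) := by
  refine ⟨by fun_prop, ?_⟩
  have h0 : (-(2 * Real.pi)) ≠ 0 := by simp [Real.pi_ne_zero]
  have h1 := Real.map_volume_mul_left h0
  have : (fun ξ : ℝ => -(2 * Real.pi * ξ)) = (-(2 * Real.pi) * ·) := by ext; ring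
  rw [this, h1]
  exact Measure.smul_absolutelyContinuous

theorem integrable_comp_neg_two_pi_mul {u : ℝ → ℂ} (hu : Integrable u) :
    Integrable fun ξ : ℝ => u (-(2 * Real.pi * ξ)) := by
  have h0 : (-(2 * Real.pi)) ≠ 0 := by simp [Real.pi_ne_zero]
  simpa using hu.comp_mul_left' h0

theorem memLp_comp_neg_two_pi_mul {u : ℝ → ℂ} (hu : MemLp u 2) :
    MemLp (fun ξ : ℝ => u (-(2 * Real.pi * ξ))) 2 := by
  have hm := hu.1.comp_quasiMeasurePreserving quasiMeasurePreserving_neg_two_pi_mul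
  refine ⟨hm, ?_⟩
  have h2 := hu.2
  rw [eLpNorm_lt_top_iff_lintegral_rpow_enorm_lt_top (by norm_num) (by norm_num)] at h2 ⊢
  rw [lintegral_comp_neg_two_pi_mul (fun t => ‖u t‖ₑ ^ (2 : ℝ≥0∞).toReal)]
  exact ENNReal.mul_lt_top ENNReal.ofReal_lt_top h2

theorem integral_exp_mul_eq_fourierInv (H : ℝ → ℂ) (x : ℝ) :
    (1 / (2 * (Real.pi : ℂ))) * ∫ t : ℝ, Complex.exp (-(Complex.I * t * x)) * H t =
      𝓕⁻ (fun ξ : ℝ => H (-(2 * Real.pi * ξ))) x := by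
  have h := Measure.integral_comp_mul_left
    (fun t : ℝ => Complex.exp (-(Complex.I * t * x)) * H t) (-(2 * Real.pi))
  have e : |(-(2 * Real.pi))⁻¹| = 1 / (2 * Real.pi) := by
    rw [abs_inv, abs_neg, abs_of_pos (by positivity), one_div]
  rw [e, Complex.real_smul] at h
  rw [Real.fourierInv_eq']
  push_cast at h
  rw [← h]
  refine integral_congr_ae (ae_of_all _ fun ξ => ?_)
  simp only [smul_eq_mul, RCLike.inner_apply, conj_trivial]
  congr 2
  · push_cast
    ring
  · ring

/-- Parseval's identity for the difference of an inverse transform and a density. -/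
theorem lintegral_norm_inverse_sub_sq {H : ℝ → ℂ} {f : ℝ → ℝ} (hH : Integrable H)
    (hH2 : MemLp H 2) (hf : Integrable f) (hF : Integrable (ft f)) (hF2 : MemLp (ft f) 2) :
    ∫⁻ x : ℝ, ENNReal.ofReal (‖(1 / (2 * (Real.pi : ℂ))) *
        (∫ t : ℝ, Complex.exp (-(Complex.I * t * x)) * H t) - (f x : ℂ)‖ ^ 2) =
      ENNReal.ofReal (1 / (2 * Real.pi)) * ∫⁻ t, ENNReal.ofReal (‖H t - ft f t‖ ^ 2) := by
  have e : 𝓕 (fun x => (f x : ℂ)) = fun ξ => ft f (-(2 * Real.pi * ξ)) :=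
    funext fun ξ => fourier_eq_ft f ξ
  have i1 := integrable_comp_neg_two_pi_mul hH
  have i2 := integrable_comp_neg_two_pi_mul hF
  -- No continuity of `f` is available, so inversion holds only almost everywhere, which suffices
  -- under the integral.
  have inv := fourierInv_fourier_ae_eq (f := fun x => (f x : ℂ)) hf.ofReal (by rw [e]; exact i2)
  rw [e] at inv
  rw [← lintegral_comp_neg_two_pi_mul (fun t => ENNReal.ofReal (‖H t - ft f t‖ ^ 2)),
    ← lintegral_norm_fourierInv_sq
      (h := fun ξ => H (-(2 * Real.pi * ξ)) - ft f (-(2 * Real.pi * ξ))) (i1.sub i2)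
      ((memLp_comp_neg_two_pi_mul hH2).sub (memLp_comp_neg_two_pi_mul hF2))]
  refine lintegral_congr_ae ?_
  filter_upwards [inv] with x hx
  rw [integral_exp_mul_eq_fourierInv, ← hx]
  congr 3
  simp only [Real.fourierInv_eq, smul_sub]
  rw [integral_sub]
  · exact (Real.fourierIntegral_convergent_iff (-x)).2 i1 |>.congr
      (ae_of_all _ fun v => by simp)
  · exact (Real.fourierIntegral_convergent_iff (-x)).2 i2 |>.congr
      (ae_of_all _ fun v => by simp)

/-! ### Densities and their characteristic functions. -/

theorem IsDensity.integrable {f : ℝ → ℝ} (hf : IsDensity f) : Integrable f := by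
  refine ⟨hf.measurable.aestronglyMeasurable, ?_⟩
  rw [hasFiniteIntegral_iff_ofReal (ae_of_all _ hf.nonneg), hf.lintegral_eq_one]
  exact ENNReal.one_lt_top

theorem IsDensity.isProbabilityMeasure {f : ℝ → ℝ} (hf : IsDensity f) :
    IsProbabilityMeasure (densityLaw f) :=
  ⟨by rw [densityLaw, withDensity_apply _ MeasurableSet.univ, Measure.restrict_univ,
    hf.lintegral_eq_one]⟩

theorem IsDensity.charFun_eq {f : ℝ → ℝ} (hf : IsDensity f) :
    charFun (densityLaw f) = ft f := by
  ext t
  rw [charFun_apply_real, ft, densityLaw,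
    integral_withDensity_eq_integral_toReal_smul hf.measurable.ennreal_ofReal
      (ae_of_all _ fun _ => ENNReal.ofReal_lt_top)]
  refine integral_congr_ae (ae_of_all _ fun x => ?_)
  simp only [ENNReal.toReal_ofReal (hf.nonneg x), Complex.real_smul]
  rw [mul_comm]
  congr 2
  ring

theorem IsDensity.measurable_ft {f : ℝ → ℝ} (hf : IsDensity f) : Measurable (ft f) := by
  have := hf.isProbabilityMeasure
  rw [← hf.charFun_eq]
  exact measurable_charFun

theorem IsDensity.norm_ft_le_one {f : ℝ → ℝ} (hf : IsDensity f) (t : ℝ) : ‖ft f t‖ ≤ 1 := by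
  have := hf.isProbabilityMeasure
  rw [← hf.charFun_eq]
  exact norm_charFun_le_one t

theorem memLp_two_of_integrable_of_bound {u : ℝ → ℂ} (hu : Integrable u) {M : ℝ}
    (hM : ∀ t, ‖u t‖ ≤ M) : MemLp u 2 := by
  rw [memLp_two_iff_integrable_sq_norm hu.1]
  refine (hu.norm.const_mul M).mono' (hu.1.norm.pow 2) (ae_of_all _ fun t => ?_)
  rw [norm_pow, norm_norm, sq]
  exact mul_le_mul_of_nonneg_right (hM t) (norm_nonneg _)

/-- With `p = (1 + t²)^β`, completing the square gives `2|f^ft| ≤ |f^ft|² p + 1/p`. The first term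
is integrable by membership in the class, the second because `2β > 1`. -/
theorem integrable_ft_of_mem_sobolevClass {β C : ℝ} (hβ : 1 / 2 < β) {f : ℝ → ℝ}
    (hf : f ∈ sobolevClass β C) : Integrable (ft f) := by
  have hm := hf.1.measurable_ft
  have h1 : Integrable fun t : ℝ => ‖ft f t‖ ^ 2 * (1 + t ^ 2) ^ β := by
    refine ⟨by fun_prop, ?_⟩
    rw [hasFiniteIntegral_iff_ofReal (ae_of_all _ fun t => by positivity)]
    exact hf.2.trans_lt ENNReal.ofReal_lt_top
  have h2 : Integrable fun t : ℝ => (1 + t ^ 2) ^ (-β) := by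
    have := integrable_rpow_neg_one_add_norm_sq (E := ℝ) (μ := volume) (r := 2 * β)
      (by simp; linarith)
    refine this.congr (ae_of_all _ fun t => ?_)
    simp only [Real.norm_eq_abs, sq_abs]
    congr 1
    ring
  refine (h1.add h2).mono' hm.aestronglyMeasurable (ae_of_all _ fun t => ?_)
  simp only [Pi.add_apply]
  have hp : 0 < (1 + t ^ 2) ^ β := by positivity
  rw [Real.rpow_neg (by positivity)]
  set p := (1 + t ^ 2) ^ β
  have e : ‖ft f t‖ ^ 2 * p + p⁻¹ = (‖ft f t‖ * p - 1) ^ 2 / p + 2 * ‖ft f t‖ := by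
    field_simp
    ring
  have : 0 ≤ (‖ft f t‖ * p - 1) ^ 2 / p := by positivity
  have := norm_nonneg (ft f t)
  linarith

/-! ### Bias-variance decomposition for sums of independent variables. -/

section Variance

variable {ι : Type*} [Fintype ι] {Ω : ι → Type*} [∀ i, MeasurableSpace (Ω i)]
  (μ : (i : ι) → Measure (Ω i)) [∀ i, IsProbabilityMeasure (μ i)]

theorem memLp_two_sum_pi {E : Type*} [NormedAddCommGroup E] {U : (i : ι) → Ω i → E}
    (hU : ∀ i, MemLp (U i) 2 (μ i)) :
    MemLp (fun ω : (i : ι) → Ω i => ∑ i, U i (ω i)) 2 (Measure.pi μ) :=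
  memLp_finsetSum _ fun i _ => (hU i).comp_measurePreserving (measurePreserving_eval _ i)

theorem integral_sum_sub_sq_pi {U : (i : ι) → Ω i → ℝ} (hU : ∀ i, MemLp (U i) 2 (μ i)) (b : ℝ) :
    ∫ ω, (∑ i, U i (ω i) - b) ^ 2 ∂(Measure.pi μ) =
      ∑ i, (∫ x, U i x ^ 2 ∂(μ i) - (∫ x, U i x ∂(μ i)) ^ 2) +
        (∑ i, ∫ x, U i x ∂(μ i) - b) ^ 2 := by
  have hL := memLp_two_sum_pi μ hU
  have hmean : ∫ ω, (∑ i, U i (ω i)) ∂(Measure.pi μ) = ∑ i, ∫ x, U i x ∂(μ i) := by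
    rw [integral_finsetSum]
    · exact Finset.sum_congr rfl fun i _ =>
        integral_comp_eval (hU i).aestronglyMeasurable
    · exact fun i _ => ((hU i).comp_measurePreserving
        (measurePreserving_eval _ i)).integrable one_le_two
  have hL' : MemLp (fun ω : (i : ι) → Ω i => ∑ i, U i (ω i) - b) 2 (Measure.pi μ) :=
    hL.sub (memLp_const b)
  have h1 := variance_eq_sub hL'
  rw [variance_sub_const hL.1] at h1
  have h2 := variance_sum_pi hU
  have e : (∑ i, fun ω : (i : ι) → Ω i => U i (ω i)) = fun ω => ∑ i, U i (ω i) := by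
    ext; simp
  rw [e, h1] at h2
  have hm' : ∫ ω, (∑ i, U i (ω i) - b) ∂(Measure.pi μ) = ∑ i, ∫ x, U i x ∂(μ i) - b := by
    rw [integral_sub (hL.integrable one_le_two) (integrable_const b), hmean]
    simp
  rw [hm', sub_eq_iff_eq_add] at h2
  refine Eq.trans (by rfl) (h2.trans ?_)
  congr 1
  exact Finset.sum_congr rfl fun i _ => variance_eq_sub (hU i)

/-- The real decomposition is applied to real and imaginary parts and the two are added. -/
theorem integral_norm_sum_sub_sq_pi {U : (i : ι) → Ω i → ℂ} (hU : ∀ i, MemLp (U i) 2 (μ i))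
    (b : ℂ) :
    ∫ ω, ‖∑ i, U i (ω i) - b‖ ^ 2 ∂(Measure.pi μ) =
      ∑ i, (∫ x, ‖U i x‖ ^ 2 ∂(μ i) - ‖∫ x, U i x ∂(μ i)‖ ^ 2) +
        ‖∑ i, ∫ x, U i x ∂(μ i) - b‖ ^ 2 := by
  have hre : ∀ i, MemLp (fun x => (U i x).re) 2 (μ i) := fun i => (hU i).re
  have him : ∀ i, MemLp (fun x => (U i x).im) 2 (μ i) := fun i => (hU i).im
  have key : ∀ z : ℂ, ‖z‖ ^ 2 = z.re ^ 2 + z.im ^ 2 := fun z => by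
    rw [← Complex.normSq_eq_norm_sq, Complex.normSq_apply]; ring
  have hi : ∀ i, Integrable (U i) (μ i) := fun i => (hU i).integrable one_le_two
  have ere : ∀ i, (∫ x, U i x ∂(μ i)).re = ∫ x, (U i x).re ∂(μ i) := fun i =>
    (integral_re (hi i)).symm
  have eim : ∀ i, (∫ x, U i x ∂(μ i)).im = ∫ x, (U i x).im ∂(μ i) := fun i =>
    (integral_im (hi i)).symm
  have h1 := integral_sum_sub_sq_pi μ hre b.re
  have h2 := integral_sum_sub_sq_pi μ him b.im
  simp only [key, Complex.sub_re, Complex.sub_im, Complex.re_sum, Complex.im_sum, ere, eim]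
  rw [integral_add, h1, h2]
  · have : ∀ i, ∫ x, (U i x).re ^ 2 + (U i x).im ^ 2 ∂(μ i) =
        ∫ x, (U i x).re ^ 2 ∂(μ i) + ∫ x, (U i x).im ^ 2 ∂(μ i) := fun i =>
      integral_add (hre i).integrable_sq (him i).integrable_sq
    simp only [this, Finset.sum_add_distrib, Finset.sum_sub_distrib]
    ring
  · exact ((memLp_two_sum_pi μ hre).sub (memLp_const b.re)).integrable_sq
  · exact ((memLp_two_sum_pi μ him).sub (memLp_const b.im)).integrable_sq

theorem lintegral_norm_sum_exp_sub_sq {n : ℕ} (ρ : Fin n → Measure ℝ)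
    [∀ j, IsProbabilityMeasure (ρ j)] (c : Fin n → ℂ) (b : ℂ) (t : ℝ) :
    ∫⁻ y, ENNReal.ofReal (‖∑ j, c j * Complex.exp (Complex.I * t * y j) - b‖ ^ 2)
        ∂(Measure.pi ρ) =
      ENNReal.ofReal (∑ j, ‖c j‖ ^ 2 * (1 - ‖charFun (ρ j) t‖ ^ 2) +
        ‖∑ j, c j * charFun (ρ j) t - b‖ ^ 2) := by
  have hn : ∀ j (x : ℝ), ‖c j * Complex.exp (Complex.I * t * x)‖ = ‖c j‖ := fun j x => by
    rw [norm_mul, mul_assoc, mul_comm Complex.I, ← Complex.ofReal_mul,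
      Complex.norm_exp_ofReal_mul_I, mul_one]
  have hU : ∀ j, MemLp (fun x : ℝ => c j * Complex.exp (Complex.I * t * x)) 2 (ρ j) := fun j =>
    MemLp.of_bound (by fun_prop) ‖c j‖ (ae_of_all _ fun x => (hn j x).le)
  have hI : ∀ j, ∫ x, c j * Complex.exp (Complex.I * t * x) ∂(ρ j) = c j * charFun (ρ j) t :=
    fun j => by
      rw [integral_const_mul, charFun_apply_real]
      congr 2
      ext x
      congr 1
      ring
  have h := integral_norm_sum_sub_sq_pi ρ hU b
  simp only [hI, hn, integral_const, probReal_univ, one_smul] at h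
  rw [← ofReal_integral_eq_lintegral_ofReal, h]
  · congr 2
    refine Finset.sum_congr rfl fun j _ => ?_
    rw [norm_mul]
    ring
  · have := ((memLp_two_sum_pi ρ hU).sub (memLp_const b))
    exact (memLp_two_iff_integrable_sq_norm this.1).1 this
  · exact ae_of_all _ fun y => by positivity

end Variance

/-! ### Law and characteristic functions of the averaged observations. -/

section Model

instance isProbabilityMeasure_avgErrorLaw (ν : Measure ℝ) [IsProbabilityMeasure ν] (m : ℕ) :
    IsProbabilityMeasure (avgErrorLaw ν m) := by
  unfold avgErrorLaw
  exact Measure.isProbabilityMeasure_map (by fun_prop)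

/-- Averaging leaves `X_j` intact (this needs `r j ≠ 0`) and averages the errors. Regrouping the
product measure by individuals then makes the averages independent, each with a convolution as its
law. -/
theorem map_averagedSample_modelLaw {f : ℝ → ℝ} (hf : IsDensity f) (ν : Measure ℝ)
    [IsProbabilityMeasure ν] {n : ℕ} (r : Fin n → ℕ) (hr : ∀ j, 1 ≤ r j) :
    (modelLaw f ν r).map averagedSample =
      Measure.pi fun j => (densityLaw f).conv (avgErrorLaw ν (r j)) := by
  have := hf.isProbabilityMeasure
  have h1 := Measure.pi_map_pi (μ := fun j : Fin n => Measure.pi fun _ : Fin (r j) => ν)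
    (f := fun j e => (∑ k, e k) / (r j : ℝ)) (fun j => by fun_prop)
  change Measure.map _ _ = Measure.pi (fun j => avgErrorLaw ν (r j)) at h1
  have h2 := (measurePreserving_arrowProdEquivProdArrow ℝ ℝ (Fin n) (fun _ => densityLaw f)
    (fun j => avgErrorLaw ν (r j))).symm.map_eq
  have h3 := Measure.pi_map_pi (μ := fun j : Fin n => (densityLaw f).prod (avgErrorLaw ν (r j)))
    (f := fun _ p => p.1 + p.2) (fun j => by fun_prop)
  change _ = Measure.pi fun j => (densityLaw f).conv (avgErrorLaw ν (r j)) at h3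
  rw [← h3, ← h2, ← h1, ← Measure.map_id (μ := Measure.pi fun _ : Fin n => densityLaw f),
    Measure.map_prod_map _ _ measurable_id (by fun_prop),
    Measure.map_map (MeasurableEquiv.measurable _) (by fun_prop),
    Measure.map_map (by fun_prop)
      ((MeasurableEquiv.measurable _).comp (by fun_prop)), modelLaw]
  congr 1
  ext p j
  have h0 : (r j : ℝ) ≠ 0 := by have := hr j; positivity
  simp only [averagedSample, observation, Finset.sum_add_distrib, Finset.sum_const,
    Finset.card_univ, Fintype.card_fin, nsmul_eq_mul, Function.comp_apply,
    MeasurableEquiv.arrowProdEquivProdArrow, MeasurableEquiv.symm_mk, MeasurableEquiv.coe_mk,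
    Equiv.arrowProdEquivProdArrow, Equiv.coe_fn_symm_mk, Prod.map_fst, Prod.map_snd, id_eq]
  field_simp

theorem measurable_averagedSample {n : ℕ} {r : Fin n → ℕ} :
    Measurable (averagedSample (r := r)) := by
  unfold averagedSample observation
  fun_prop

theorem charFun_avgErrorLaw (ν : Measure ℝ) [IsProbabilityMeasure ν] (m : ℕ) (t : ℝ) :
    charFun (avgErrorLaw ν m) t = charFun ν (t / m) ^ m := by
  rw [charFun_apply_real, avgErrorLaw, integral_map (by fun_prop) (by fun_prop),
    charFun_apply_real]
  have h := integral_fintype_prod_eq_pow (μ := ν) (ι := Fin m)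
    (fun x : ℝ => Complex.exp ((t / m : ℝ) * x * Complex.I))
  rw [Fintype.card_fin] at h
  rw [← h]
  refine integral_congr_ae (ae_of_all _ fun e => ?_)
  simp only
  rw [← Complex.exp_sum]
  congr 1
  push_cast
  rw [Finset.sum_div, Finset.mul_sum, Finset.sum_mul]
  exact Finset.sum_congr rfl fun k _ => by ring

/-- The mean `μ` contributes only a phase, and averaging divides the variance by `r j`. -/
theorem norm_avgErrorFT_gaussian_sq (μ : ℝ) (σ : ℝ≥0) {n : ℕ} (r : Fin n → ℕ) (j : Fin n)
    (hr : 1 ≤ r j) (t : ℝ) :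
    ‖avgErrorFT (gaussianReal μ (σ ^ 2)) r j t‖ ^ 2 =
      Real.exp (-((σ : ℝ) ^ 2 / r j * t ^ 2)) := by
  have h0 : (r j : ℝ) ≠ 0 := by positivity
  rw [avgErrorFT, charFun_avgErrorLaw, charFun_gaussianReal, norm_pow, Complex.norm_exp,
    ← Real.exp_nat_mul, ← Real.exp_nat_mul]
  congr 1
  have : (((t / r j : ℝ) : ℂ) * μ * Complex.I
      - ((σ ^ 2 : ℝ≥0) : ℝ) * ((t / r j : ℝ) : ℂ) ^ 2 / 2).re
      = -((σ : ℝ) ^ 2 * (t / r j) ^ 2 / 2) := by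
    have e : ((((σ ^ 2 : ℝ≥0) : ℝ) : ℂ) * ((t / r j : ℝ) : ℂ) ^ 2 / 2)
      = (((σ : ℝ) ^ 2 * (t / r j) ^ 2 / 2 : ℝ) : ℂ) := by push_cast; ring
    rw [e, ← Complex.ofReal_mul, Complex.sub_re, Complex.ofReal_re, Complex.re_ofReal_mul]
    simp
  rw [this]
  field_simp
  ring

end Model

/-! ### The risk in the Fourier domain. -/

/-- The integrand of the mean integrated squared error in the Fourier domain: the variance of
`z * Ψ_n(t)` plus the squared bias, where `a` is the value of the target characteristic function. -/
noncomputable def riskDensity {n : ℕ} (g : Fin n → ℝ → ℂ) (z a : ℂ) (t : ℝ) : ℝ :=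
  ‖z‖ ^ 2 * (∑ j, ‖g j t‖ ^ 2 * (1 - ‖a‖ ^ 2 * ‖g j t‖ ^ 2)) / (∑ k, ‖g k t‖ ^ 2) ^ 2 +
    ‖z - 1‖ ^ 2 * ‖a‖ ^ 2

theorem norm_Psi_le {n : ℕ} (g : Fin n → ℝ → ℂ) (hg : ∀ j t, ‖g j t‖ ≤ 1) (y : Fin n → ℝ) {t m : ℝ}
    (hm : 0 < m) (hS : m ≤ ∑ k, ‖g k t‖ ^ 2) : ‖Psi g y t‖ ≤ n / m := by
  rw [Psi, norm_div, Complex.norm_real, Real.norm_eq_abs, abs_of_pos (hm.trans_le hS)]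
  refine div_le_div₀ (by positivity) ((norm_sum_le _ _).trans ?_) hm hS
  refine (Finset.sum_le_card_nsmul _ _ 1 fun j _ => ?_).trans (by simp)
  rw [norm_mul, mul_assoc, mul_comm Complex.I, ← Complex.ofReal_mul,
      Complex.norm_exp_ofReal_mul_I, mul_one]
  exact hg j _

theorem measurable_Psi {n : ℕ} {g : Fin n → ℝ → ℂ} (hg : ∀ j, Measurable (g j)) :
    Measurable fun q : (Fin n → ℝ) × ℝ => Psi g q.1 q.2 := by
  unfold Psi
  fun_prop

theorem measurable_Psi_averagedSample {n : ℕ} {g : Fin n → ℝ → ℂ} (hg : ∀ j, Measurable (g j))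
    {r : Fin n → ℕ} :
    Measurable fun q : SampleSpace r × ℝ => Psi g (averagedSample q.1) q.2 := by
  have h1 : Measurable fun q : SampleSpace r × ℝ => averagedSample q.1 :=
    measurable_averagedSample.comp measurable_fst
  unfold Psi
  refine Measurable.div (Finset.measurable_sum _ fun j _ => ?_) ?_
  · have h2 : Measurable fun q : SampleSpace r × ℝ => averagedSample q.1 j :=
      (measurable_pi_apply j).comp h1
    have h3 : Measurable fun q : SampleSpace r × ℝ => g j (-q.2) :=
      (hg j).comp measurable_snd.neg
    exact h3.mul (Complex.measurable_exp.comp ((measurable_const.mul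
      (Complex.measurable_ofReal.comp measurable_snd)).mul (Complex.measurable_ofReal.comp h2)))
  · have h3 : Measurable fun t : ℝ => (((∑ k, ‖g k t‖ ^ 2 : ℝ)) : ℂ) := by fun_prop
    exact h3.comp measurable_snd

/-- `Psi` is unbiased for `f^ft`: since `g_j(-t)` is the conjugate of `g_j(t)`, the weights turn
`g_j` into `|g_j|²`, whose sum cancels the denominator. The bias of `z * Psi` is thus `(z - 1)
f^ft`. -/
theorem lintegral_risk_integrand {f : ℝ → ℝ} (hf : IsDensity f) (ν : Measure ℝ)
    [IsProbabilityMeasure ν] {n : ℕ} (r : Fin n → ℕ) (hr : ∀ j, 1 ≤ r j) (z : ℂ) (t : ℝ)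
    (hS : 0 < ∑ k, ‖avgErrorFT ν r k t‖ ^ 2) :
    ∫⁻ p, ENNReal.ofReal (‖z * Psi (avgErrorFT ν r) (averagedSample p) t - ft f t‖ ^ 2)
        ∂(modelLaw f ν r) =
      ENNReal.ofReal (riskDensity (avgErrorFT ν r) z (ft f t) t) := by
  have := hf.isProbabilityMeasure
  have hgm : ∀ j, Measurable (avgErrorFT ν r j) := fun j => measurable_charFun
  rw [← lintegral_map (μ := modelLaw f ν r)
    (f := fun y => ENNReal.ofReal (‖z * Psi (avgErrorFT ν r) y t - ft f t‖ ^ 2)) ?_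
    measurable_averagedSample, map_averagedSample_modelLaw hf ν r hr]
  swap
  · have := (measurable_Psi hgm).comp (measurable_prodMk_right (y := t))
    simp only [Function.comp_def] at this
    fun_prop
  set S : ℝ := ∑ k, ‖avgErrorFT ν r k t‖ ^ 2 with hSdef
  have hS0 : (S : ℂ) ≠ 0 := by exact_mod_cast hS.ne'
  have e1 : ∀ y : Fin n → ℝ, z * Psi (avgErrorFT ν r) y t =
      ∑ j, (z * avgErrorFT ν r j (-t) / S) * Complex.exp (Complex.I * t * y j) := fun y => by
    rw [Psi, ← hSdef, Finset.sum_div, Finset.mul_sum]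
    exact Finset.sum_congr rfl fun j _ => by ring
  simp only [e1]
  rw [lintegral_norm_sum_exp_sub_sq]
  have hneg : ∀ j, avgErrorFT ν r j (-t) = (starRingEnd ℂ) (avgErrorFT ν r j t) := fun j =>
    charFun_neg t
  have hc : ∀ j, charFun ((densityLaw f).conv (avgErrorLaw ν (r j))) t
      = ft f t * avgErrorFT ν r j t := fun j => by
    rw [charFun_conv, hf.charFun_eq]; rfl
  have hsum : ∑ j, z * avgErrorFT ν r j (-t) / S * (ft f t * avgErrorFT ν r j t)
      = z * ft f t := by
    have : ∀ j, z * avgErrorFT ν r j (-t) / S * (ft f t * avgErrorFT ν r j t)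
        = z * ft f t / S * ((‖avgErrorFT ν r j t‖ ^ 2 : ℝ) : ℂ) := fun j => by
      rw [hneg, Complex.ofReal_pow, ← Complex.conj_mul']
      ring
    simp only [this]
    rw [← Finset.mul_sum, ← Complex.ofReal_sum, ← hSdef]
    field_simp
  congr 1
  simp only [hc, hsum]
  rw [riskDensity, ← hSdef]
  congr 1
  · rw [Finset.mul_sum, Finset.sum_div]
    refine Finset.sum_congr rfl fun j _ => ?_
    rw [norm_div, norm_mul, norm_mul, hneg, RCLike.norm_conj, Complex.norm_real,
      Real.norm_eq_abs, abs_of_pos hS]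
    ring
  · rw [← mul_pow, ← norm_mul]
    congr 2
    ring

theorem aestronglyMeasurable_comp_div {φ : ℝ → ℂ} (hφ : AEStronglyMeasurable φ) {w : ℝ}
    (hw : w ≠ 0) : AEStronglyMeasurable fun t => φ (t / w) := by
  refine hφ.comp_quasiMeasurePreserving (f := fun t => t / w) ⟨by fun_prop, ?_⟩
  have h1 := Real.map_volume_mul_right (inv_ne_zero hw)
  have : (fun t : ℝ => t / w) = (· * w⁻¹) := by ext; rw [div_eq_mul_inv]
  rw [this, h1]
  exact Measure.smul_absolutelyContinuous

/-- The mean integrated squared error as an integral in the Fourier domain. -/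
theorem mise_eq_lintegral {f : ℝ → ℝ} (hf : IsDensity f) (hF : Integrable (ft f)) (ν : Measure ℝ)
    [IsProbabilityMeasure ν] {n : ℕ} (r : Fin n → ℕ) (hr : ∀ j, 1 ≤ r j) {φ : ℝ → ℂ}
    (hφ : AEStronglyMeasurable φ) (hφ1 : ∀ t, ‖φ t‖ ≤ 1) (hφ0 : ∀ t, 1 < |t| → φ t = 0) {w : ℝ}
    (hw : 0 < w) (hS : ∀ t, 0 < ∑ k, ‖avgErrorFT ν r k t‖ ^ 2) {m : ℝ} (hm : 0 < m)
    (hSm : ∀ t, |t| ≤ w → m ≤ ∑ k, ‖avgErrorFT ν r k t‖ ^ 2) :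
    mise φ w f ν r = ENNReal.ofReal (1 / (2 * Real.pi)) *
      ∫⁻ t, ENNReal.ofReal (riskDensity (avgErrorFT ν r) (φ (t / w)) (ft f t) t) := by
  have := hf.isProbabilityMeasure
  have : IsProbabilityMeasure (modelLaw f ν r) := by unfold modelLaw; infer_instance
  set g := avgErrorFT ν r with hg
  have hgm : ∀ j, Measurable (g j) := fun j => measurable_charFun
  have hg1 : ∀ j t, ‖g j t‖ ≤ 1 := fun j t => norm_charFun_le_one t
  have hφw := aestronglyMeasurable_comp_div hφ hw.ne'
  have hH : ∀ y : Fin n → ℝ, Integrable (fun t => φ (t / w) * Psi g y t) ∧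
      MemLp (fun t => φ (t / w) * Psi g y t) 2 := fun y => by
    -- For each fixed sample the integrand is bounded, by the lower bound `m` on the energy, and
    -- vanishes off `[-w, w]`. It therefore lies in L¹ ∩ L², and Parseval applies sample by sample.
    have hmeas : AEStronglyMeasurable (fun t => φ (t / w) * Psi g y t) :=
      hφw.mul ((measurable_Psi hgm).comp measurable_prodMk_left).aestronglyMeasurable
    have hsupp : ∀ t, w < |t| → φ (t / w) = 0 := fun t ht => hφ0 _ (by
      rwa [abs_div, abs_of_pos hw, one_lt_div hw])
    have hb : ∀ t, ‖φ (t / w) * Psi g y t‖ ≤ n / m := fun t => by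
      rcases le_or_gt |t| w with h | h
      · rw [norm_mul]
        exact (mul_le_of_le_one_left (norm_nonneg _) (hφ1 _)).trans
          (norm_Psi_le g hg1 y hm (hSm t h))
      · rw [hsupp t h]
        simp only [zero_mul, norm_zero]
        positivity
    have hi : Integrable (fun t => φ (t / w) * Psi g y t) := by
      rw [← integrableOn_iff_integrable_of_support_subset (s := Set.Icc (-w) w)]
      · exact Measure.integrableOn_of_bounded (by simp) hmeas (ae_of_all _ hb)
      · intro t ht
        by_contra hcon
        apply ht
        simp only
        rw [hsupp t (by rwa [← not_le, abs_le]), zero_mul]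
    exact ⟨hi, memLp_two_of_integrable_of_bound hi hb⟩
  have hF2 := memLp_two_of_integrable_of_bound hF hf.norm_ft_le_one
  have h1 : ∀ p : SampleSpace r, ∫⁻ x : ℝ, ENNReal.ofReal
      (‖estimator φ w g (averagedSample p) x - (f x : ℂ)‖ ^ 2) =
      ENNReal.ofReal (1 / (2 * Real.pi)) * ∫⁻ t, ENNReal.ofReal
        (‖φ (t / w) * Psi g (averagedSample p) t - ft f t‖ ^ 2) := fun p => by
    rw [← lintegral_norm_inverse_sub_sq (hH _).1 (hH _).2 hf.integrable hF hF2]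
    simp only [estimator, mul_assoc]
  have hjoint : AEMeasurable (Function.uncurry fun (p : SampleSpace r) (t : ℝ) => ENNReal.ofReal
      (‖φ (t / w) * Psi g (averagedSample p) t - ft f t‖ ^ 2))
      ((modelLaw f ν r).prod volume) := by
    have a1 : AEStronglyMeasurable (fun q : SampleSpace r × ℝ => φ (q.2 / w))
      ((modelLaw f ν r).prod volume) := hφw.comp_snd
    have a2 : Measurable (fun q : SampleSpace r × ℝ => Psi g (averagedSample q.1) q.2) :=
      measurable_Psi_averagedSample hgm
    exact (((a1.aemeasurable.mul a2.aemeasurable).sub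
      (hf.measurable_ft.comp measurable_snd).aemeasurable).norm.pow_const 2).ennreal_ofReal
  rw [mise]
  simp only [← hg, h1]
  rw [lintegral_const_mul' _ _ ENNReal.ofReal_ne_top, lintegral_lintegral_swap hjoint]
  congr 1
  exact lintegral_congr fun t => lintegral_risk_integrand hf ν r hr _ t (hS t)

theorem riskDensity_le {n : ℕ} (g : Fin n → ℝ → ℂ) (z a : ℂ) (t : ℝ) :
    riskDensity g z a t ≤ ‖z‖ ^ 2 / (∑ k, ‖g k t‖ ^ 2) + ‖z - 1‖ ^ 2 * ‖a‖ ^ 2 := by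
  rw [riskDensity]
  gcongr ?_ + _
  have h : (∑ j, ‖g j t‖ ^ 2 * (1 - ‖a‖ ^ 2 * ‖g j t‖ ^ 2)) ≤ ∑ k, ‖g k t‖ ^ 2 :=
    Finset.sum_le_sum fun j _ => mul_le_of_le_one_right (by positivity)
      (sub_le_self _ (by positivity))
  -- When the energy vanishes, both quotients are 0 by the convention for division by zero.
  rcases (Finset.sum_nonneg fun k _ => by positivity :
    0 ≤ ∑ k, ‖g k t‖ ^ 2).eq_or_lt with h0 | h0
  · simp [← h0]
  · rw [div_le_div_iff₀ (by positivity) h0]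
    have := mul_le_mul_of_nonneg_left h (by positivity : 0 ≤ ‖z‖ ^ 2 * ∑ k, ‖g k t‖ ^ 2)
    linarith

theorem le_riskDensity {n : ℕ} (g : Fin n → ℝ → ℂ) (hg : ∀ j t, ‖g j t‖ ≤ 1) (z a : ℂ) (t : ℝ) :
    ‖z‖ ^ 2 * (1 - ‖a‖ ^ 2) / (∑ k, ‖g k t‖ ^ 2) + ‖z - 1‖ ^ 2 * ‖a‖ ^ 2 ≤
      riskDensity g z a t := by
  rw [riskDensity]
  gcongr ?_ + _
  have h : (1 - ‖a‖ ^ 2) * ∑ k, ‖g k t‖ ^ 2 ≤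
      (∑ j, ‖g j t‖ ^ 2 * (1 - ‖a‖ ^ 2 * ‖g j t‖ ^ 2)) := by
    rw [Finset.mul_sum]
    refine Finset.sum_le_sum fun j _ => ?_
    rw [mul_comm]
    have h1 : ‖g j t‖ ^ 2 ≤ 1 := pow_le_one₀ (norm_nonneg _) (hg j t)
    have h2 := mul_le_of_le_one_right (by positivity : 0 ≤ ‖a‖ ^ 2) h1
    gcongr
  rcases (Finset.sum_nonneg fun k _ => by positivity :
    0 ≤ ∑ k, ‖g k t‖ ^ 2).eq_or_lt with h0 | h0
  · simp [← h0]
  · rw [div_le_div_iff₀ h0 (by positivity)]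
    have := mul_le_mul_of_nonneg_left h (by positivity : 0 ≤ ‖z‖ ^ 2 * ∑ k, ‖g k t‖ ^ 2)
    linarith

/-! ### Construction of kernels; the sinc kernel. -/

/-- A Hermitian function in `L¹ ∩ L²` is the Fourier transform of a real kernel. -/
theorem exists_isKernelWithFT {φ : ℝ → ℂ} (hφ : Integrable φ) (hφ2 : MemLp φ 2)
    (hsymm : ∀ t, φ (-t) = (starRingEnd ℂ) (φ t)) : ∃ K, IsKernelWithFT K φ := by
  set h : ℝ → ℂ := fun ξ => φ (-(2 * Real.pi * ξ)) with hh
  have i1 : Integrable h := integrable_comp_neg_two_pi_mul hφ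
  have i2 : MemLp h 2 := memLp_comp_neg_two_pi_mul hφ2
  have hconj : ∀ x, (starRingEnd ℂ) (𝓕⁻ h x) = 𝓕⁻ h x := fun x => by
    rw [Real.fourierInv_eq', ← integral_conj]
    -- Reflecting `ξ` turns the Hermitian symmetry of `φ` into reality of the inverse transform.
    conv_rhs => rw [← integral_neg_eq_self]
    refine integral_congr_ae (ae_of_all _ fun ξ => ?_)
    simp only [hh, smul_eq_mul, RCLike.inner_apply, conj_trivial, map_mul, ← hsymm,
      ← Complex.exp_conj, Complex.conj_ofReal, Complex.conj_I]
    congr 2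
    · push_cast
      ring
    · ring
  have hre : ∀ x, (((𝓕⁻ h x).re : ℝ) : ℂ) = 𝓕⁻ h x := fun x => Complex.conj_eq_iff_re.1 (hconj x)
  have hae := fourierInv_toLp_ae_eq i1 i2
  have hK : MemLp (fun x => (((𝓕⁻ h x).re : ℝ) : ℂ)) 2 := by
    simp only [hre]
    exact (memLp_congr_ae hae).2 (Lp.memLp _)
  refine ⟨fun x => (𝓕⁻ h x).re, hK, ?_⟩
  have e : hK.toLp _ = 𝓕⁻ (i2.toLp h) := by
    apply Lp.ext
    filter_upwards [hK.coeFn_toLp, hae] with x hx1 hx2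
    rw [hx1, hre, hx2]
  rw [e, FourierTransform.fourier_fourierInv_eq]
  exact i2.coeFn_toLp.symm

/-- The Fourier transform of the sinc kernel. -/
noncomputable def sincFT : ℝ → ℂ := (Set.Icc (-1) 1).indicator fun _ => 1

theorem sincFT_of_le {t : ℝ} (ht : |t| ≤ 1) : sincFT t = 1 :=
  Set.indicator_of_mem (Set.mem_Icc.2 (abs_le.1 ht)) _

theorem sincFT_of_lt {t : ℝ} (ht : 1 < |t|) : sincFT t = 0 :=
  Set.indicator_of_notMem (fun h => ht.not_ge (abs_le.2 (Set.mem_Icc.1 h))) _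

theorem norm_sincFT_le_one (t : ℝ) : ‖sincFT t‖ ≤ 1 := by
  rcases le_or_gt |t| 1 with h | h
  · simp [sincFT_of_le h]
  · simp [sincFT_of_lt h]

theorem measurable_sincFT : Measurable sincFT :=
  measurable_const.indicator measurableSet_Icc

theorem integrable_of_bound_of_support {u : ℝ → ℂ} (hu : AEStronglyMeasurable u) {M : ℝ}
    (hM : ∀ t, ‖u t‖ ≤ M) (h0 : ∀ t, 1 < |t| → u t = 0) : Integrable u := by
  rw [← integrableOn_iff_integrable_of_support_subset (s := Set.Icc (-1) 1)]
  · exact Measure.integrableOn_of_bounded (by simp) hu (ae_of_all _ hM)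
  · intro t ht
    by_contra hcon
    exact ht (h0 t (by rwa [← not_le, abs_le]))

theorem exists_isKernelWithFT_sincFT : ∃ K, IsKernelWithFT K sincFT := by
  have hi : Integrable sincFT := integrable_of_bound_of_support
    measurable_sincFT.aestronglyMeasurable norm_sincFT_le_one fun t => sincFT_of_lt
  refine exists_isKernelWithFT hi (memLp_two_of_integrable_of_bound hi norm_sincFT_le_one)
    fun t => ?_
  rcases le_or_gt |t| 1 with h | h
  · rw [sincFT_of_le h, sincFT_of_le (by rwa [abs_neg]), map_one]
  · rw [sincFT_of_lt h, sincFT_of_lt (by rwa [abs_neg]), map_zero]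

theorem sincFT_eventuallyEq_one : sincFT =ᶠ[𝓝 0] fun _ => 1 := by
  filter_upwards [Icc_mem_nhds (show (-1 : ℝ) < 0 by norm_num) one_pos] with t ht
  exact sincFT_of_le (abs_le.2 ht)

theorem conditionB_sincFT (β : ℝ) : ConditionB β sincFT where
  norm_le_one := norm_sincFT_le_one
  support := fun t => sincFT_of_lt
  order := by
    refine (isLittleO_zero _ _).congr' ?_ EventuallyEq.rfl
    filter_upwards [sincFT_eventuallyEq_one] with t ht
    rw [ht, sub_self]

/-! ### Gaussian errors and the upper bound on the risk. -/

section Gaussian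

variable (μ : ℝ) (σ : ℝ≥0) {n : ℕ} (r : Fin n → ℕ)

/-- `∑ |f_{ε_k}^ft(t)|²` for averaged Gaussian errors. -/
noncomputable def errorEnergy (t : ℝ) : ℝ := ∑ k, Real.exp (-((σ : ℝ) ^ 2 / r k * t ^ 2))

variable {r}

theorem sum_norm_avgErrorFT_sq (hr : ∀ j, 1 ≤ r j) (t : ℝ) :
    ∑ k, ‖avgErrorFT (gaussianReal μ (σ ^ 2)) r k t‖ ^ 2 = errorEnergy σ r t :=
  Finset.sum_congr rfl fun k _ => norm_avgErrorFT_gaussian_sq μ σ r k (hr k) t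

theorem errorEnergy_pos (hn : 1 ≤ n) (t : ℝ) : 0 < errorEnergy σ r t := by
  have : Nonempty (Fin n) := ⟨⟨0, hn⟩⟩
  exact Finset.sum_pos (fun k _ => Real.exp_pos _) Finset.univ_nonempty

theorem errorEnergy_anti {s t : ℝ} (h : |s| ≤ |t|) : errorEnergy σ r t ≤ errorEnergy σ r s := by
  refine Finset.sum_le_sum fun k _ => Real.exp_le_exp.2 (neg_le_neg ?_)
  have := sq_le_sq.2 h
  gcongr

theorem mise_gaussian_eq {f : ℝ → ℝ} (hf : IsDensity f) (hF : Integrable (ft f)) (hn : 1 ≤ n)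
    (hr : ∀ j, 1 ≤ r j) {φ : ℝ → ℂ} (hφ : AEStronglyMeasurable φ) (hφ1 : ∀ t, ‖φ t‖ ≤ 1)
    (hφ0 : ∀ t, 1 < |t| → φ t = 0) {w : ℝ} (hw : 0 < w) :
    mise φ w f (gaussianReal μ (σ ^ 2)) r = ENNReal.ofReal (1 / (2 * Real.pi)) *
      ∫⁻ t, ENNReal.ofReal
        (riskDensity (avgErrorFT (gaussianReal μ (σ ^ 2)) r) (φ (t / w)) (ft f t) t) := by
  refine mise_eq_lintegral hf hF _ r hr hφ hφ1 hφ0 hw (fun t => ?_)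
    (errorEnergy_pos σ (r := r) hn w)
    fun t ht => ?_
  · rw [sum_norm_avgErrorFT_sq μ σ hr]
    exact errorEnergy_pos σ hn t
  · rw [sum_norm_avgErrorFT_sq μ σ hr]
    exact errorEnergy_anti σ (by rwa [abs_of_pos hw])

theorem conditionA_sincFT (hn : 1 ≤ n) (hr : ∀ j, 1 ≤ r j) (w : ℝ) :
    ConditionA (avgErrorFT (gaussianReal μ (σ ^ 2)) r) sincFT w where
  exists_ne_zero := by
    refine ⟨⟨0, hn⟩, fun t h0 => ?_⟩
    have := norm_avgErrorFT_gaussian_sq μ σ r ⟨0, hn⟩ (hr _) t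
    rw [h0, norm_zero, zero_pow two_ne_zero] at this
    exact (Real.exp_pos _).ne this
  bounded := ⟨1, norm_sincFT_le_one⟩
  continuousAt := continuousAt_const.congr sincFT_eventuallyEq_one.symm
  map_zero := sincFT_of_le (by simp)
  memLp := by
    intro j
    set g := avgErrorFT (gaussianReal μ (σ ^ 2)) r with hg
    have hgm : ∀ k, Measurable (g k) := fun k => measurable_charFun
    have hms := measurable_sincFT
    have hm : Measurable fun t : ℝ =>
      g j (t * w) * sincFT t / ((∑ k, ‖g k (t * w)‖ ^ 2 : ℝ) : ℂ) := by fun_prop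
    have h0 : ∀ t : ℝ, 1 < |t| →
        g j (t * w) * sincFT t / ((∑ k, ‖g k (t * w)‖ ^ 2 : ℝ) : ℂ) = 0 := fun t ht => by
      rw [sincFT_of_lt ht, mul_zero, zero_div]
    have hb : ∀ t : ℝ, ‖g j (t * w) * sincFT t / ((∑ k, ‖g k (t * w)‖ ^ 2 : ℝ) : ℂ)‖ ≤
        1 / errorEnergy σ r w := fun t => by
      have hpos := errorEnergy_pos σ (r := r) hn w
      rcases le_or_gt |t| 1 with h | h
      · rw [norm_div, Complex.norm_real, sum_norm_avgErrorFT_sq μ σ hr, Real.norm_eq_abs,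
          abs_of_pos (errorEnergy_pos σ hn _), norm_mul]
        refine div_le_div₀ zero_le_one
          (mul_le_one₀ (norm_charFun_le_one _) (norm_nonneg _) (norm_sincFT_le_one t)) hpos
          (errorEnergy_anti σ ?_)
        rw [abs_mul]
        exact mul_le_of_le_one_left (abs_nonneg _) h
      · rw [h0 t h, norm_zero]
        positivity
    have hi := integrable_of_bound_of_support hm.aestronglyMeasurable hb h0
    exact memLp_two_of_integrable_of_bound hi hb

/-- Inside the band the sinc kernel has no bias and the variance density is at most `1/S(w)`, as `S`
decreases in `|t|`. Outside only `|f^ft|²` remains, and there `1 ≤ w^(-2β) (1 + t²)^β`. -/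
theorem supMise_sincFT_le {β C : ℝ} (hβ : 1 / 2 < β) (hC : 0 < C) (hn : 1 ≤ n)
    (hr : ∀ j, 1 ≤ r j) {w : ℝ} (hw : 0 < w) :
    supMise β C sincFT w (gaussianReal μ (σ ^ 2)) r ≤
      ENNReal.ofReal (2 * w / errorEnergy σ r w + C * w ^ (-(2 * β))) := by
  have hpos := errorEnergy_pos σ (r := r) hn w
  refine iSup₂_le fun f hf => ?_
  rw [mise_gaussian_eq μ σ hf.1 (integrable_ft_of_mem_sobolevClass hβ hf) hn hr
    measurable_sincFT.aestronglyMeasurable norm_sincFT_le_one (fun t => sincFT_of_lt) hw]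
  have hpi : ENNReal.ofReal (1 / (2 * Real.pi)) ≤ 1 := by
    rw [ENNReal.ofReal_le_one, div_le_one (by positivity)]
    linarith [Real.pi_gt_three]
  refine (mul_le_of_le_one_left zero_le hpi).trans ?_
  have hpt : ∀ t, ENNReal.ofReal (riskDensity (avgErrorFT (gaussianReal μ (σ ^ 2)) r)
      (sincFT (t / w)) (ft f t) t) ≤
      (Set.Icc (-w) w).indicator (fun _ => ENNReal.ofReal (1 / errorEnergy σ r w)) t +
        ENNReal.ofReal (w ^ (-(2 * β))) *
          ENNReal.ofReal (‖ft f t‖ ^ 2 * (1 + t ^ 2) ^ β) := fun t => by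
    have h1 := riskDensity_le (avgErrorFT (gaussianReal μ (σ ^ 2)) r) (sincFT (t / w)) (ft f t) t
    rw [sum_norm_avgErrorFT_sq μ σ hr] at h1
    refine (ENNReal.ofReal_le_ofReal h1).trans ?_
    rcases le_or_gt |t| w with h | h
    · rw [sincFT_of_le (by rwa [abs_div, abs_of_pos hw, div_le_one hw]),
        Set.indicator_of_mem (show t ∈ Set.Icc (-w) w from abs_le.1 h)]
      refine le_add_right (ENNReal.ofReal_le_ofReal ?_)
      simp only [norm_one, one_pow, sub_self, norm_zero]
      have := one_div_le_one_div_of_le hpos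
        (errorEnergy_anti σ (r := r) (s := t) (t := w) (by rwa [abs_of_pos hw]))
      linarith
    · rw [sincFT_of_lt (by rwa [abs_div, abs_of_pos hw, one_lt_div hw])]
      refine le_add_left ?_
      rw [← ENNReal.ofReal_mul (by positivity)]
      refine ENNReal.ofReal_le_ofReal ?_
      have h2 : w ^ (2 * β) ≤ (1 + t ^ 2) ^ β := by
        rw [Real.rpow_mul hw.le, Real.rpow_two]
        refine Real.rpow_le_rpow (by positivity) ?_ (by linarith)
        have := sq_le_sq' (by linarith) h.le
        rw [sq_abs] at this
        linarith
      have h3 : 1 ≤ w ^ (-(2 * β)) * (1 + t ^ 2) ^ β := by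
        rw [Real.rpow_neg hw.le, ← div_eq_inv_mul, one_le_div (by positivity)]
        exact h2
      have h4 := mul_le_mul_of_nonneg_left h3 (sq_nonneg ‖ft f t‖)
      simp only [norm_zero, zero_sub, norm_neg, norm_one]
      rw [zero_pow two_ne_zero, zero_div]
      linarith
  refine (lintegral_mono hpt).trans ?_
  rw [lintegral_add_left (measurable_const.indicator measurableSet_Icc),
    lintegral_indicator measurableSet_Icc, setLIntegral_const,
    lintegral_const_mul' _ _ ENNReal.ofReal_ne_top, ENNReal.ofReal_add (by positivity)
    (by positivity)]
  refine add_le_add ?_ ?_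
  · rw [Real.volume_Icc, ← ENNReal.ofReal_mul (by positivity)]
    refine ENNReal.ofReal_le_ofReal (le_of_eq ?_)
    ring
  · rw [mul_comm C, ENNReal.ofReal_mul (by positivity)]
    gcongr
    exact hf.2

end Gaussian

theorem card_mul_exp_le_errorEnergy (σ : ℝ≥0) (r : (n : ℕ) → Fin n → ℕ) (n : ℕ) (γ α w : ℝ) :
    ((smallVarianceSet σ r n γ α).ncard : ℝ) *
      Real.exp (-(γ * (n : ℝ) ^ (-α) * Real.log n * w ^ 2)) ≤ errorEnergy σ (r n) w := by
  classical
  rw [Set.ncard_eq_toFinset_card', ← nsmul_eq_mul]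
  refine (Finset.card_nsmul_le_sum _ (fun k => Real.exp (-((σ : ℝ) ^ 2 / r n k * w ^ 2))) _
    fun j hj => ?_).trans (Finset.sum_le_sum_of_subset_of_nonneg (Finset.subset_univ _)
      fun k _ _ => (Real.exp_pos _).le)
  have hj' : (σ : ℝ) ^ 2 / (r n j : ℝ) < γ * (n : ℝ) ^ (-α) * Real.log n := by
    rw [Set.mem_toFinset] at hj
    exact hj
  rw [Real.exp_le_exp, neg_le_neg_iff]
  gcongr

theorem algebraicRatesAttainable_of_card {β C μ : ℝ} {σ : ℝ≥0} (hβ : 1 / 2 < β) (hC : 0 < C)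
    {r : (n : ℕ) → Fin n → ℕ} (hr : ∀ n j, 1 ≤ r n j) {α γ c δ : ℝ} (hα : 0 < α) (hγ : 0 < γ)
    (hc : 0 < c) (hδ : 0 < δ)
    (h : ∀ n : ℕ, 2 ≤ n → c * (n : ℝ) ^ δ ≤ ((smallVarianceSet σ r n γ α).ncard : ℝ)) :
    AlgebraicRatesAttainable β C (gaussianReal μ (σ ^ 2)) r := by
  obtain ⟨K, hK⟩ := exists_isKernelWithFT_sincFT
  -- `a ≤ α/4` leaves a factor `n^(-α/2)` to absorb the logarithm in `σ_j² w²`; `a ≤ δ/4` gives `a -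
  -- δ ≤ -a`.
  obtain ⟨a, ha, haα, haδ⟩ : ∃ a : ℝ, 0 < a ∧ a ≤ α / 4 ∧ a ≤ δ / 4 :=
    ⟨min (α / 4) (δ / 4), by positivity, min_le_left _ _, min_le_right _ _⟩
  -- The maximum with 1 keeps the bandwidth positive at `n = 0`.
  have hw : ∀ n : ℕ, 0 < ((max n 1 : ℕ) : ℝ) ^ a := fun n => by
    have : 0 < max n 1 := by simp
    positivity
  refine ⟨K, sincFT, fun n => ((max n 1 : ℕ) : ℝ) ^ a, hK, conditionB_sincFT β, hw,
    fun n hn => conditionA_sincFT μ σ hn (hr n) _, a, ha,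
    2 / (c * Real.exp (-(γ * (2 / α)))) + C, ?_⟩
  filter_upwards [eventually_ge_atTop 2] with n hn
  rw [max_eq_left (by omega)]
  have hn1 : (1 : ℝ) ≤ n := by exact_mod_cast (by omega : 1 ≤ n)
  have hn0 : (0 : ℝ) < n := by linarith
  set w : ℝ := (n : ℝ) ^ a with hwdef
  have hwpos : 0 < w := by positivity
  refine (supMise_sincFT_le μ σ hβ hC (by omega) (hr n) hwpos).trans
    (ENNReal.ofReal_le_ofReal ?_)
  rw [add_mul]
  refine add_le_add ?_ ?_
  · have hexp : Real.exp (-(γ * (2 / α))) ≤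
        Real.exp (-(γ * (n : ℝ) ^ (-α) * Real.log n * w ^ 2)) := by
      rw [Real.exp_le_exp, neg_le_neg_iff]
      have e1 : w ^ 2 = (n : ℝ) ^ (2 * a) := by
        rw [hwdef, ← Real.rpow_natCast, ← Real.rpow_mul hn0.le]
        congr 1
        push_cast
        ring
      have e2 : (n : ℝ) ^ (-α) * w ^ 2 ≤ (n : ℝ) ^ (-(α / 2)) := by
        rw [e1, ← Real.rpow_add hn0]
        exact Real.rpow_le_rpow_of_exponent_le hn1 (by linarith)
      have e3 : Real.log n ≤ (n : ℝ) ^ (α / 2) / (α / 2) :=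
        Real.log_le_rpow_div hn0.le (by positivity)
      have e4 : (n : ℝ) ^ (-(α / 2)) * (n : ℝ) ^ (α / 2) = 1 := by
        rw [← Real.rpow_add hn0]; simp
      have hlog : 0 ≤ Real.log n := Real.log_nonneg hn1
      calc γ * (n : ℝ) ^ (-α) * Real.log n * w ^ 2
          = γ * (((n : ℝ) ^ (-α) * w ^ 2) * Real.log n) := by ring
        _ ≤ γ * ((n : ℝ) ^ (-(α / 2)) * ((n : ℝ) ^ (α / 2) / (α / 2))) := by gcongr
        _ = γ * (((n : ℝ) ^ (-(α / 2)) * (n : ℝ) ^ (α / 2)) * (2 / α)) := by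
          field_simp
        _ = γ * (2 / α) := by rw [e4, one_mul]
    have hS : c * (n : ℝ) ^ δ * Real.exp (-(γ * (2 / α))) ≤ errorEnergy σ (r n) w :=
      (mul_le_mul (h n hn) hexp (Real.exp_pos _).le (by positivity)).trans
        (card_mul_exp_le_errorEnergy σ r n γ α w)
    calc 2 * w / errorEnergy σ (r n) w
        ≤ 2 * w / (c * (n : ℝ) ^ δ * Real.exp (-(γ * (2 / α)))) := by gcongr
      _ = 2 / (c * Real.exp (-(γ * (2 / α)))) * (n : ℝ) ^ (a - δ) := by
        rw [Real.rpow_sub hn0, ← hwdef]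
        field_simp
      _ ≤ _ := by
        gcongr
        linarith
  · gcongr
    rw [hwdef, ← Real.rpow_mul hn0.le]
    refine Real.rpow_le_rpow_of_exponent_le hn1 ?_
    have := mul_le_mul_of_nonneg_left hβ.le ha.le
    linarith

/-! ### Gamma densities as test densities in the Sobolev class. -/

theorem integrableOn_pow_mul_cexp_neg_mul {z : ℂ} (hz : 0 < z.re) (k : ℕ) :
    IntegrableOn (fun x : ℝ => (x : ℂ) ^ k * Complex.exp (-(z * x))) (Set.Ioi 0) := by
  have h := integrableOn_rpow_mul_exp_neg_mul_rpow (p := 1) (s := k) (b := z.re)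
    (by have := k.cast_nonneg (α := ℝ); linarith) one_pos hz
  refine h.mono' (by fun_prop) ((ae_restrict_iff' measurableSet_Ioi).2 (ae_of_all _ fun x hx => ?_))
  have hx0 : (0 : ℝ) < x := hx
  rw [norm_mul, norm_pow, Complex.norm_real, Real.norm_eq_abs, abs_of_pos hx0, Complex.norm_exp,
    Real.rpow_natCast, Real.rpow_one]
  simp

theorem integral_pow_mul_cexp_neg_mul_Ioi {z : ℂ} (hz : 0 < z.re) (k : ℕ) :
    ∫ x : ℝ in Set.Ioi 0, (x : ℂ) ^ k * Complex.exp (-(z * x)) = k.factorial / z ^ (k + 1) := by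
  have hz0 : z ≠ 0 := fun h => by simp [h] at hz
  induction k with
  | zero =>
    have h := integral_exp_mul_complex_Ioi (a := -z) (by simpa using hz) 0
    simp only [neg_mul] at h
    simp [h]
  | succ k ih =>
    have hd : ∀ x : ℝ, HasDerivAt (fun x : ℝ => (x : ℂ) ^ (k + 1) * Complex.exp (-(z * x)))
        ((k + 1 : ℂ) * ((x : ℂ) ^ k * Complex.exp (-(z * x))) -
          z * ((x : ℂ) ^ (k + 1) * Complex.exp (-(z * x)))) x := fun x => by
      have h1 : HasDerivAt (fun x : ℝ => (x : ℂ)) 1 x := Complex.ofRealCLM.hasDerivAt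
      have h2 := (h1.pow (k + 1)).mul (h1.const_mul z).neg.cexp
      refine h2.congr_deriv ?_
      simp only [Pi.neg_apply, Pi.pow_apply]
      rw [Nat.add_sub_cancel]
      push_cast
      ring
    have i1 := (integrableOn_pow_mul_cexp_neg_mul hz k).const_mul (k + 1 : ℂ)
    have i2 := (integrableOn_pow_mul_cexp_neg_mul hz (k + 1)).const_mul z
    have ht : Tendsto (fun x : ℝ => (x : ℂ) ^ (k + 1) * Complex.exp (-(z * x))) atTop (𝓝 0) := by
      rw [tendsto_zero_iff_norm_tendsto_zero]
      refine (tendsto_rpow_mul_exp_neg_mul_atTop_nhds_zero (k + 1 : ℕ) z.re hz).congr' ?_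
      filter_upwards [eventually_gt_atTop 0] with x hx
      rw [norm_mul, norm_pow, Complex.norm_real, Real.norm_eq_abs, abs_of_pos hx,
        Complex.norm_exp, Real.rpow_natCast]
      simp
    have h := integral_Ioi_of_hasDerivAt_of_tendsto' (a := 0) (fun x _ => hd x) (i1.sub i2) ht
    rw [integral_sub i1 i2, integral_const_mul, integral_const_mul, ih] at h
    simp only [Complex.ofReal_zero, ne_eq, Nat.add_eq_zero_iff, one_ne_zero, and_false,
      not_false_eq_true, zero_pow, zero_mul, sub_zero] at h
    rw [sub_eq_zero] at h
    rw [← mul_right_inj' hz0, ← h, Nat.factorial_succ]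
    push_cast
    field_simp
    ring

theorem isDensity_gammaPDFReal {a ρ : ℝ} (ha : 0 < a) (hρ : 0 < ρ) :
    IsDensity (gammaPDFReal a ρ) :=
  ⟨measurable_gammaPDFReal a ρ, gammaPDFReal_nonneg ha hρ, lintegral_gammaPDF_eq_one ha hρ⟩

theorem ft_gammaPDFReal (k : ℕ) {ρ : ℝ} (hρ : 0 < ρ) (t : ℝ) :
    ft (gammaPDFReal (k + 1 : ℕ) ρ) t = (ρ / (ρ - t * Complex.I)) ^ (k + 1) := by
  have hz : 0 < ((ρ : ℂ) - t * Complex.I).re := by simpa using hρ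
  have hz0 : (ρ : ℂ) - t * Complex.I ≠ 0 := fun h => by rw [h] at hz; simp at hz
  have hf : ((k.factorial : ℕ) : ℂ) ≠ 0 := by exact_mod_cast k.factorial_ne_zero
  rw [ft, ← setIntegral_eq_integral_of_forall_compl_eq_zero (s := Set.Ici 0),
    integral_Ici_eq_integral_Ioi]
  · have h : ∀ x ∈ Set.Ioi (0 : ℝ),
        Complex.exp (Complex.I * t * x) * (gammaPDFReal (k + 1 : ℕ) ρ x : ℂ) =
          ((ρ : ℂ) ^ (k + 1) / k.factorial) *
            ((x : ℂ) ^ k * Complex.exp (-((ρ - t * Complex.I) * x))) := fun x hx => by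
      have e : -(((ρ : ℂ) - t * Complex.I) * x) = Complex.I * t * x + -(ρ * x) := by ring
      rw [gammaPDFReal, if_pos (le_of_lt hx), Nat.cast_succ, Real.Gamma_nat_eq_factorial,
        ← Nat.cast_succ, Real.rpow_natCast, Nat.cast_succ, add_sub_cancel_right,
        Real.rpow_natCast, e, Complex.exp_add, Nat.succ_eq_add_one]
      push_cast
      ring
    rw [setIntegral_congr_fun measurableSet_Ioi h, integral_const_mul,
      integral_pow_mul_cexp_neg_mul_Ioi hz, div_pow]
    field_simp
  · intro x hx
    rw [gammaPDFReal, if_neg (fun h => hx (Set.mem_Ici.2 h)), Complex.ofReal_zero, mul_zero]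

theorem norm_ft_gammaPDFReal_sq (k : ℕ) {ρ : ℝ} (hρ : 0 < ρ) (t : ℝ) :
    ‖ft (gammaPDFReal (k + 1 : ℕ) ρ) t‖ ^ 2 = (ρ ^ 2 / (ρ ^ 2 + t ^ 2)) ^ (k + 1) := by
  rw [ft_gammaPDFReal k hρ, norm_pow, ← pow_mul, mul_comm (k + 1), pow_mul, norm_div, div_pow,
    ← Complex.normSq_eq_norm_sq, ← Complex.normSq_eq_norm_sq, Complex.normSq_apply,
    Complex.normSq_apply]
  congr 2
  · simp [sq]
  · simp [sq]

/-- Of the `k + 1` factors of `|f^ft|²`, `k` absorb the weight, because `1 + t² ≤ (ρ² + t²)/ρ²` for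
`ρ ≤ 1`. The remaining one is a Cauchy profile with integral `ρπ`, so a small rate `ρ` fits any `C >
0`. -/
theorem gammaPDFReal_mem_sobolevClass {β C : ℝ} {k : ℕ} (hk : β ≤ k) {ρ : ℝ}
    (hρ : 0 < ρ) (hρ1 : ρ ≤ 1) (hC : ρ * Real.pi ≤ C) :
    gammaPDFReal (k + 1 : ℕ) ρ ∈ sobolevClass β C := by
  refine ⟨isDensity_gammaPDFReal (by positivity) hρ, ?_⟩
  have hint : Integrable fun t : ℝ => (1 + (t / ρ) ^ 2)⁻¹ :=
    integrable_inv_one_add_sq.comp_div hρ.ne'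
  have hval : ∫ t : ℝ, (1 + (t / ρ) ^ 2)⁻¹ = ρ * Real.pi := by
    rw [Measure.integral_comp_div (fun t : ℝ => (1 + t ^ 2)⁻¹) ρ, integral_univ_inv_one_add_sq,
      abs_of_pos hρ, smul_eq_mul]
  refine le_trans ?_ (ENNReal.ofReal_le_ofReal hC)
  rw [← hval, ofReal_integral_eq_lintegral_ofReal hint (ae_of_all _ fun t => by positivity)]
  refine lintegral_mono fun t => ENNReal.ofReal_le_ofReal ?_
  rw [norm_ft_gammaPDFReal_sq k hρ, pow_succ]
  have hd : 0 < ρ ^ 2 + t ^ 2 := by positivity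
  have h1 : (1 + t ^ 2) ^ β ≤ ((ρ ^ 2 + t ^ 2) / ρ ^ 2) ^ k := by
    refine (Real.rpow_le_rpow_of_exponent_le (by nlinarith) hk).trans ?_
    rw [Real.rpow_natCast]
    refine pow_le_pow_left₀ (by positivity) ?_ k
    rw [le_div_iff₀ (by positivity)]
    have : ρ ^ 2 ≤ 1 := pow_le_one₀ hρ.le hρ1
    nlinarith [sq_nonneg t]
  have h2 : (ρ ^ 2 / (ρ ^ 2 + t ^ 2)) ^ k * ((ρ ^ 2 + t ^ 2) / ρ ^ 2) ^ k = 1 := by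
    rw [← mul_pow]
    field_simp
    simp
  have h3 : (1 + (t / ρ) ^ 2)⁻¹ = ρ ^ 2 / (ρ ^ 2 + t ^ 2) := by
    field_simp
  calc (ρ ^ 2 / (ρ ^ 2 + t ^ 2)) ^ k * (ρ ^ 2 / (ρ ^ 2 + t ^ 2)) * (1 + t ^ 2) ^ β
      ≤ (ρ ^ 2 / (ρ ^ 2 + t ^ 2)) ^ k * (ρ ^ 2 / (ρ ^ 2 + t ^ 2)) *
        ((ρ ^ 2 + t ^ 2) / ρ ^ 2) ^ k := by gcongr
    _ = ((ρ ^ 2 / (ρ ^ 2 + t ^ 2)) ^ k * ((ρ ^ 2 + t ^ 2) / ρ ^ 2) ^ k) *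
        (ρ ^ 2 / (ρ ^ 2 + t ^ 2)) := by ring
    _ = _ := by rw [h2, h3, one_mul]

theorem IsKernelWithFT.aestronglyMeasurable {K : ℝ → ℝ} {φ : ℝ → ℂ} (h : IsKernelWithFT K φ) :
    AEStronglyMeasurable φ := by
  obtain ⟨hK, hφ⟩ := h
  have h1 : AEStronglyMeasurable fun ξ : ℝ => φ (-(2 * Real.pi * ξ)) :=
    (Lp.aestronglyMeasurable _).congr hφ.symm
  have h0 : (-(2 * Real.pi)) ≠ 0 := by simp [Real.pi_ne_zero]
  refine (aestronglyMeasurable_comp_div h1 h0).congr (ae_of_all _ fun t => ?_)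
  simp only
  congr 1
  field_simp

theorem ofReal_le_lintegral_of_le {R : ℝ → ℝ} {a b L : ℝ} (hL : 0 ≤ L)
    (h : ∀ t, a < t → t ≤ b → L ≤ R t) :
    ENNReal.ofReal ((b - a) * L) ≤ ∫⁻ t, ENNReal.ofReal (R t) := by
  calc ENNReal.ofReal ((b - a) * L)
      = ∫⁻ _ in Set.Ioc a b, ENNReal.ofReal L := by
        rw [setLIntegral_const, Real.volume_Ioc, mul_comm, ENNReal.ofReal_mul hL]
    _ ≤ ∫⁻ t in Set.Ioc a b, ENNReal.ofReal (R t) :=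
        setLIntegral_mono' measurableSet_Ioc fun t ht => ENNReal.ofReal_le_ofReal (h t ht.1 ht.2)
    _ ≤ _ := setLIntegral_le_lintegral _ _

/-! ### Lower bounds on the risk. -/

section LowerBounds

variable {β C μ : ℝ} {σ : ℝ≥0} {n : ℕ} {r : Fin n → ℕ} {φ : ℝ → ℂ} {w : ℝ} {f : ℝ → ℝ}

theorem le_supMise (hβ : 1 / 2 < β) (hf : f ∈ sobolevClass β C) (hn : 1 ≤ n)
    (hr : ∀ j, 1 ≤ r j) (hφm : AEStronglyMeasurable φ) (hφ : ConditionB β φ) (hw : 0 < w)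
    {a b L : ℝ} (hL : 0 ≤ L)
    (h : ∀ t, a < t → t ≤ b →
      L ≤ ‖φ (t / w)‖ ^ 2 * (1 - ‖ft f t‖ ^ 2) / errorEnergy σ r t +
        ‖φ (t / w) - 1‖ ^ 2 * ‖ft f t‖ ^ 2) :
    ENNReal.ofReal (1 / (2 * Real.pi) * ((b - a) * L)) ≤
      supMise β C φ w (gaussianReal μ (σ ^ 2)) r := by
  refine le_trans ?_ (le_iSup₂_of_le f hf le_rfl)
  rw [mise_gaussian_eq μ σ hf.1 (integrable_ft_of_mem_sobolevClass hβ hf) hn hr hφm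
    hφ.norm_le_one hφ.support hw, ENNReal.ofReal_mul (by positivity)]
  gcongr
  refine ofReal_le_lintegral_of_le hL fun t hat htb => (h t hat htb).trans ?_
  rw [← sum_norm_avgErrorFT_sq μ σ hr]
  exact le_riskDensity _ (fun j t => norm_charFun_le_one t) _ _ _

/-- On `(V, 2V]`, with `V = max w 1`, the kernel transform vanishes and the whole of `|f^ft|²` is
lost. There `ρ² + t² ≤ 5V²`, and the interval has length at least 1. -/
theorem bias_le_supMise (hβ : 1 / 2 < β) (hf : f ∈ sobolevClass β C) (hn : 1 ≤ n)
    (hr : ∀ j, 1 ≤ r j) (hφm : AEStronglyMeasurable φ) (hφ : ConditionB β φ) (hw : 0 < w)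
    {ρ : ℝ} (hρ : 0 < ρ) (hρ1 : ρ ≤ 1) {m : ℕ}
    (hft : ∀ t, ‖ft f t‖ ^ 2 = (ρ ^ 2 / (ρ ^ 2 + t ^ 2)) ^ m) :
    ENNReal.ofReal (1 / (2 * Real.pi) * ((ρ ^ 2 / 5) ^ m / (max w 1) ^ (2 * m))) ≤
      supMise β C φ w (gaussianReal μ (σ ^ 2)) r := by
  set V := max w 1
  have hV1 : 1 ≤ V := le_max_right _ _
  have hL : 0 ≤ (ρ ^ 2 / 5) ^ m / V ^ (2 * m) := by positivity
  refine le_trans (ENNReal.ofReal_le_ofReal ?_)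
    (le_supMise hβ hf hn hr hφm hφ hw (a := V) (b := 2 * V) hL fun t h1 h2 => ?_)
  · gcongr
    exact le_mul_of_one_le_left hL (by linarith)
  · have hwt : w < t := (le_max_left w 1).trans_lt h1
    have ht : 0 < t := by linarith
    rw [hφ.support _ (by rwa [abs_of_pos (by positivity), one_lt_div hw]), hft]
    simp only [norm_zero, zero_sub, norm_neg, norm_one]
    rw [zero_pow two_ne_zero, zero_mul, zero_div, zero_add, one_pow, one_mul, pow_mul, ← div_pow]
    refine pow_le_pow_left₀ (by positivity) ?_ m
    rw [div_div, div_le_div_iff_of_pos_left (by positivity) (by positivity) (by positivity)]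
    nlinarith

/-- On `(wη/2, wη]` both `|φ(t/w)|²` and `1 - |f^ft|²` are at least `1/2`, and `S(t) ≤ S(wη/2)`. The
condition `2 ≤ wη` makes the interval at least 1 long and keeps `t ≥ 1`. -/
theorem variance_le_supMise (hβ : 1 / 2 < β) (hf : f ∈ sobolevClass β C) (hn : 1 ≤ n)
    (hr : ∀ j, 1 ≤ r j) (hφm : AEStronglyMeasurable φ) (hφ : ConditionB β φ) (hw : 0 < w)
    {η : ℝ} (hφη : ∀ t, |t| ≤ η → 1 / 2 ≤ ‖φ t‖ ^ 2) (hwη : 2 ≤ w * η)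
    (hft : ∀ t, 1 ≤ t → ‖ft f t‖ ^ 2 ≤ 1 / 2) :
    ENNReal.ofReal (1 / (8 * Real.pi) / errorEnergy σ r (w * η / 2)) ≤
      supMise β C φ w (gaussianReal μ (σ ^ 2)) r := by
  have hS := errorEnergy_pos σ (r := r) hn (w * η / 2)
  have hL : 0 ≤ 1 / 4 / errorEnergy σ r (w * η / 2) := by positivity
  refine le_trans (ENNReal.ofReal_le_ofReal ?_)
    (le_supMise hβ hf hn hr hφm hφ hw (a := w * η / 2) (b := w * η) hL fun t h1 h2 => ?_)
  · have : 1 * (1 / 4 / errorEnergy σ r (w * η / 2)) ≤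
        (w * η - w * η / 2) * (1 / 4 / errorEnergy σ r (w * η / 2)) :=
      mul_le_mul_of_nonneg_right (by linarith) hL
    calc 1 / (8 * Real.pi) / errorEnergy σ r (w * η / 2)
        = 1 / (2 * Real.pi) * (1 * (1 / 4 / errorEnergy σ r (w * η / 2))) := by
          field_simp
          norm_num
      _ ≤ _ := by gcongr
  · have ht1 : 1 ≤ t := by linarith
    have ht : 0 < t := by linarith
    refine le_add_of_le_of_nonneg ?_ (by positivity)
    refine div_le_div₀ ?_ ?_ (errorEnergy_pos σ hn t) (errorEnergy_anti σ ?_)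
    · have := hft t ht1
      have : 0 ≤ 1 - ‖ft f t‖ ^ 2 := by linarith
      positivity
    · have h3 := hφη (t / w) (by
        rw [abs_of_pos (by positivity), div_le_iff₀ hw]; linarith)
      have h4 := hft t ht1
      nlinarith
    · rw [abs_of_pos (by linarith), abs_of_pos ht]
      exact h1.le

end LowerBounds

/-! ### From the risk to the number of small variances. -/

/-- An index outside the set has `σ_j² w² ≥ ln n` and contributes at most `1/n`; the others
contribute at most 1 each. -/
theorem errorEnergy_le_card_add_one (σ : ℝ≥0) (r : (n : ℕ) → Fin n → ℕ) {n : ℕ} (hn : 1 ≤ n)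
    {γ α w : ℝ} (hw : 1 ≤ γ * (n : ℝ) ^ (-α) * w ^ 2) :
    errorEnergy σ (r n) w ≤ ((smallVarianceSet σ r n γ α).ncard : ℝ) + 1 := by
  classical
  have hn0 : (0 : ℝ) < n := by exact_mod_cast hn
  have hpt : ∀ k, Real.exp (-((σ : ℝ) ^ 2 / r n k * w ^ 2)) ≤
      (if k ∈ smallVarianceSet σ r n γ α then 1 else 0) + (n : ℝ)⁻¹ := fun k => by
    split_ifs with hk
    · have : Real.exp (-((σ : ℝ) ^ 2 / r n k * w ^ 2)) ≤ 1 :=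
        Real.exp_le_one_iff.2 (neg_nonpos.2 (by positivity))
      have : 0 < (n : ℝ)⁻¹ := by positivity
      linarith
    · have hk' : γ * (n : ℝ) ^ (-α) * Real.log n ≤ (σ : ℝ) ^ 2 / r n k := not_lt.1 hk
      have hlog : 0 ≤ Real.log n := Real.log_nonneg (by exact_mod_cast hn)
      rw [zero_add, ← Real.exp_log (inv_pos.2 hn0), Real.exp_le_exp, Real.log_inv, neg_le_neg_iff]
      calc Real.log n ≤ (γ * (n : ℝ) ^ (-α) * w ^ 2) * Real.log n :=
            le_mul_of_one_le_left hlog hw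
        _ = (γ * (n : ℝ) ^ (-α) * Real.log n) * w ^ 2 := by ring
        _ ≤ _ := by gcongr
  refine (Finset.sum_le_sum fun k _ => hpt k).trans (le_of_eq ?_)
  rw [Finset.sum_add_distrib, Finset.sum_boole, Finset.sum_const, Finset.card_univ,
    Fintype.card_fin, nsmul_eq_mul, mul_inv_cancel₀ hn0.ne', Set.ncard_eq_toFinset_card']
  congr 3
  ext k
  simp

theorem smallVarianceSet_mono (σ : ℝ≥0) (r : (n : ℕ) → Fin n → ℕ) {n : ℕ} (hn : 1 ≤ n)
    {γ γ' α : ℝ} (h : γ ≤ γ') : smallVarianceSet σ r n γ α ⊆ smallVarianceSet σ r n γ' α := by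
  intro j hj
  have hj' : (σ : ℝ) ^ 2 / (r n j : ℝ) < γ * (n : ℝ) ^ (-α) * Real.log n := hj
  have hlog : 0 ≤ Real.log n := Real.log_nonneg (by exact_mod_cast hn)
  exact hj'.trans_le (by gcongr)

/-- A lower bound on the number of small variances that holds for large samples can be extended to
all samples by changing the constants. -/
theorem exists_forall_card_of_eventually {σ : ℝ≥0} {r : (n : ℕ) → Fin n → ℕ}
    (hr : ∀ n j, 1 ≤ r n j) {α γ c δ : ℝ} (hα : 0 < α) (hγ : 0 < γ) (hc : 0 < c) (hδ : 0 < δ)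
    (h : ∀ᶠ n : ℕ in atTop, c * (n : ℝ) ^ δ ≤ ((smallVarianceSet σ r n γ α).ncard : ℝ)) :
    ∃ γ' c' : ℝ, 0 < γ' ∧ 0 < c' ∧ ∀ n : ℕ, 2 ≤ n →
      c' * (n : ℝ) ^ δ ≤ ((smallVarianceSet σ r n γ' α).ncard : ℝ) := by
  obtain ⟨N₀, hN₀⟩ := eventually_atTop.1 h
  set N := max N₀ 1
  have hN1 : (1 : ℝ) ≤ N := by exact_mod_cast le_max_right N₀ 1
  have hl2 : 0 < Real.log 2 := Real.log_pos one_lt_two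
  have hNδ : 0 < (N : ℝ) ^ (-δ) := by positivity
  -- For `2 ≤ n < N` the enlarged constant puts the threshold above `σ²`, so every index counts. The
  -- constant `N^(-δ)` then makes the required number at most 1.
  refine ⟨γ + ((σ : ℝ) ^ 2 + 1) * (N : ℝ) ^ α / Real.log 2, min c ((N : ℝ) ^ (-δ)),
    by positivity, by positivity, fun n hn => ?_⟩
  have hn0 : (0 : ℝ) < n := by exact_mod_cast (by omega : 0 < n)
  have hγ' : γ ≤ γ + ((σ : ℝ) ^ 2 + 1) * (N : ℝ) ^ α / Real.log 2 :=
    le_add_of_nonneg_right (by positivity)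
  rcases le_or_gt N n with hNn | hNn
  · refine le_trans ?_ ((hN₀ n ((le_max_left _ _).trans hNn)).trans ?_)
    · gcongr
      exact min_le_left _ _
    · exact_mod_cast Set.ncard_le_ncard (smallVarianceSet_mono σ r (by omega) hγ')
  · have hle : (n : ℝ) ≤ N := by exact_mod_cast hNn.le
    have huniv : smallVarianceSet σ r n
        (γ + ((σ : ℝ) ^ 2 + 1) * (N : ℝ) ^ α / Real.log 2) α = Set.univ := by
      refine Set.eq_univ_of_forall fun j => ?_
      change (σ : ℝ) ^ 2 / (r n j : ℝ) < _
      have h1 : (σ : ℝ) ^ 2 / (r n j : ℝ) ≤ (σ : ℝ) ^ 2 :=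
        div_le_self (by positivity) (by exact_mod_cast hr n j)
      have h2 : Real.log 2 ≤ Real.log n :=
        Real.log_le_log two_pos (by exact_mod_cast hn)
      have h3 : 1 ≤ (N : ℝ) ^ α * (n : ℝ) ^ (-α) := by
        rw [Real.rpow_neg hn0.le, ← div_eq_mul_inv, one_le_div (by positivity)]
        gcongr
      have h4 : 0 ≤ γ * (n : ℝ) ^ (-α) * Real.log n := by
        have : 0 ≤ Real.log n := hl2.le.trans h2
        positivity
      calc (σ : ℝ) ^ 2 / (r n j : ℝ) < ((σ : ℝ) ^ 2 + 1) * 1 * 1 := by linarith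
        _ ≤ ((σ : ℝ) ^ 2 + 1) * ((N : ℝ) ^ α * (n : ℝ) ^ (-α)) *
            (Real.log n / Real.log 2) := by
          gcongr
          exact (one_le_div hl2).2 h2
        _ ≤ γ * (n : ℝ) ^ (-α) * Real.log n + ((σ : ℝ) ^ 2 + 1) *
            ((N : ℝ) ^ α * (n : ℝ) ^ (-α)) * (Real.log n / Real.log 2) :=
          le_add_of_nonneg_left h4
        _ = _ := by
          field_simp
    rw [huniv, Set.ncard_univ, Nat.card_eq_fintype_card, Fintype.card_fin]
    calc min c ((N : ℝ) ^ (-δ)) * (n : ℝ) ^ δ ≤ (N : ℝ) ^ (-δ) * (N : ℝ) ^ δ := by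
          gcongr
          exact min_le_right _ _
      _ = 1 := by rw [← Real.rpow_add (by linarith)]; simp
      _ ≤ n := by exact_mod_cast (by omega : 1 ≤ n)

theorem exists_half_le_norm_sq {φ : ℝ → ℂ} (hc : ContinuousAt φ 0) (h0 : φ 0 = 1) :
    ∃ η : ℝ, 0 < η ∧ ∀ t, |t| ≤ η → 1 / 2 ≤ ‖φ t‖ ^ 2 := by
  have h : Tendsto (fun t => ‖φ t‖ ^ 2) (𝓝 0) (𝓝 (‖φ 0‖ ^ 2)) := (hc.norm.pow 2)
  rw [h0, norm_one, one_pow] at h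
  obtain ⟨η, hη, hη'⟩ := Metric.nhds_basis_closedBall.eventually_iff.1
    (h.eventually (lt_mem_nhds (by norm_num : (1 / 2 : ℝ) < 1)))
  exact ⟨η, hη, fun t ht => (hη' (by simpa using ht)).le⟩

theorem exists_card_of_algebraicRatesAttainable {β C μ : ℝ} {σ : ℝ≥0} (hβ : 1 / 2 < β)
    (hC : 0 < C) {r : (n : ℕ) → Fin n → ℕ} (hr : ∀ n j, 1 ≤ r n j)
    (h : AlgebraicRatesAttainable β C (gaussianReal μ (σ ^ 2)) r) :
    ∃ α γ c δ : ℝ, 0 < α ∧ 0 < γ ∧ 0 < c ∧ 0 < δ ∧ ∀ n : ℕ, 2 ≤ n →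
      c * (n : ℝ) ^ δ ≤ ((smallVarianceSet σ r n γ α).ncard : ℝ) := by
  obtain ⟨K, φ, w, hK, hφ, hw, hA, κ, hκ, A₀, hrate⟩ := h
  have hφm := hK.aestronglyMeasurable
  -- The kernel does not vary with `n`, so one `η` serves all sample sizes.
  obtain ⟨η, hη, hφη⟩ := exists_half_le_norm_sq (hA 1 le_rfl).continuousAt (hA 1 le_rfl).map_zero
  obtain ⟨A, hA0, hAA⟩ : ∃ A : ℝ, 0 < A ∧ A₀ ≤ A :=
    ⟨max A₀ 1, by positivity, le_max_left _ _⟩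
  obtain ⟨k, hk⟩ := exists_nat_ge β
  obtain ⟨ρ, hρ, hρ1, hρC⟩ : ∃ ρ : ℝ, 0 < ρ ∧ ρ ≤ 1 ∧ ρ * Real.pi ≤ C :=
    ⟨min 1 (C / Real.pi), by positivity, min_le_left _ _,
      (le_div_iff₀ Real.pi_pos).1 (min_le_right _ _)⟩
  have hf := gammaPDFReal_mem_sobolevClass hk hρ hρ1 hρC
  have hft := norm_ft_gammaPDFReal_sq k hρ
  set f := gammaPDFReal (k + 1 : ℕ) ρ
  have hft2 : ∀ t, 1 ≤ t → ‖ft f t‖ ^ 2 ≤ 1 / 2 := fun t ht => by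
    have h1 : ρ ^ 2 / (ρ ^ 2 + t ^ 2) ≤ 1 / 2 := by
      rw [div_le_div_iff₀ (by positivity) two_pos]
      nlinarith
    rw [hft]
    exact (pow_le_of_le_one (by positivity) (h1.trans (by norm_num)) k.succ_ne_zero).trans h1
  set m := k + 1
  have hm : (0 : ℝ) < m := by positivity
  -- The bias bound will read `c₁ n^κ ≤ w^(2m)`; its `m`-th root is `c₂ n^α ≤ w²` with `α = κ/m`.
  -- The value `γ = 4/(c₂ η²)` then gives `γ n^(-α) (wη/2)² ≥ 1`.
  set c₁ := 1 / (2 * Real.pi) * (ρ ^ 2 / 5) ^ m / A with hc₁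
  have hc₁pos : 0 < c₁ := by positivity
  set c₂ := c₁ ^ (1 / (m : ℝ))
  have hc₂pos : 0 < c₂ := by positivity
  set α := κ / m with hα
  have hαpos : 0 < α := by positivity
  have hγpos : 0 < 4 / (c₂ * η ^ 2) := by positivity
  have hcpos : 0 < 1 / (16 * Real.pi * A) := by positivity
  have hlim : ∀ s : ℝ, 0 < s → Tendsto (fun n : ℕ => (n : ℝ) ^ s) atTop atTop := fun s hs =>
    (tendsto_rpow_atTop hs).comp tendsto_natCast_atTop_atTop
  obtain ⟨γ', c', hγ', hc', hall⟩ := exists_forall_card_of_eventually (σ := σ) hr hαpos hγpos hcpos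
    hκ (by
      filter_upwards [hrate, eventually_ge_atTop 1, (hlim κ hκ).eventually_gt_atTop (1 / c₁),
        (hlim α hαpos).eventually_ge_atTop (4 / (c₂ * η ^ 2)),
        (hlim κ hκ).eventually_ge_atTop (16 * Real.pi * A)] with n hn hn1 hnκ hnα hnA
      have hn0 : (0 : ℝ) < n := by exact_mod_cast hn1
      have hrate' : supMise β C φ (w n) (gaussianReal μ (σ ^ 2)) (r n) ≤
          ENNReal.ofReal (A * (n : ℝ) ^ (-κ)) := hn.trans (by gcongr)
      have hup : 0 ≤ A * (n : ℝ) ^ (-κ) := by positivity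
      have hbias := (ENNReal.ofReal_le_ofReal_iff hup).1
        ((bias_le_supMise hβ hf hn1 (hr n) hφm hφ (hw n) hρ hρ1 hft).trans hrate')
      have hV : c₁ * (n : ℝ) ^ κ ≤ (max (w n) 1) ^ (2 * m) := by
        rw [Real.rpow_neg hn0.le, ← mul_div_assoc, div_le_iff₀ (by positivity)] at hbias
        rw [hc₁, div_mul_eq_mul_div, div_le_iff₀ hA0, ← le_div_iff₀ (by positivity)]
        refine hbias.trans (le_of_eq ?_)
        field_simp
      have hone : 1 < c₁ * (n : ℝ) ^ κ := by
        rwa [div_lt_iff₀ hc₁pos, mul_comm] at hnκ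
      -- For large `n` the bias bound exceeds 1, so the maximum with 1 is `w n` itself.
      have hw1 : 1 < w n := by
        by_contra hcon
        rw [max_eq_right (not_lt.1 hcon), one_pow] at hV
        linarith
      rw [max_eq_left hw1.le, pow_mul] at hV
      have hw2 : c₂ * (n : ℝ) ^ α ≤ w n ^ 2 := by
        refine le_of_pow_le_pow_left₀ k.succ_ne_zero (by positivity) (le_trans (le_of_eq ?_) hV)
        rw [mul_pow, ← Real.rpow_natCast, ← Real.rpow_natCast, ← Real.rpow_mul hc₁pos.le,
          ← Real.rpow_mul hn0.le, hα, div_mul_cancel₀ _ hm.ne', div_mul_cancel₀ _ hm.ne',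
          Real.rpow_one]
      have hwη : 2 ≤ w n * η := by
        rw [div_le_iff₀ (by positivity)] at hnα
        refine le_of_pow_le_pow_left₀ two_ne_zero (by positivity) ?_
        calc (2 : ℝ) ^ 2 ≤ (n : ℝ) ^ α * (c₂ * η ^ 2) := by linarith
          _ = c₂ * (n : ℝ) ^ α * η ^ 2 := by ring
          _ ≤ w n ^ 2 * η ^ 2 := by gcongr
          _ = (w n * η) ^ 2 := by ring
      have hvar := (ENNReal.ofReal_le_ofReal_iff hup).1
        ((variance_le_supMise hβ hf hn1 (hr n) hφm hφ (hw n) hφη hwη hft2).trans hrate')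
      have hSpos := errorEnergy_pos σ (r := r n) hn1 (w n * η / 2)
      -- The factor 2 is kept aside: once `n^κ ≥ 16πA`, one of the two copies absorbs the `+ 1` in
      -- the count.
      have hS : 2 * (1 / (16 * Real.pi * A) * (n : ℝ) ^ κ) ≤
          errorEnergy σ (r n) (w n * η / 2) := by
        rw [div_le_iff₀ hSpos, Real.rpow_neg hn0.le, ← div_eq_mul_inv, div_mul_eq_mul_div,
          le_div_iff₀ (by positivity), ← div_le_iff₀' hA0] at hvar
        refine le_trans (le_of_eq ?_) hvar
        field_simp
        norm_num
      have hcard := errorEnergy_le_card_add_one σ r hn1 (γ := 4 / (c₂ * η ^ 2)) (α := α)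
        (w := w n * η / 2) (by
          calc (1 : ℝ) = 4 / (c₂ * η ^ 2) * (n : ℝ) ^ (-α) *
                (c₂ * (n : ℝ) ^ α * η ^ 2 / 4) := by
                rw [Real.rpow_neg hn0.le]
                field_simp
            _ ≤ 4 / (c₂ * η ^ 2) * (n : ℝ) ^ (-α) * (w n ^ 2 * η ^ 2 / 4) := by gcongr
            _ = _ := by ring)
      have hbig : 1 ≤ 1 / (16 * Real.pi * A) * (n : ℝ) ^ κ := by
        rw [one_div, ← div_eq_inv_mul]
        exact (one_le_div (by positivity)).2 hnA
      linarith)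
  exact ⟨α, γ', c', κ, hαpos, hγ', hc', hκ, hall⟩

end Deconvolution

theorem theorem3p2 (β C μ : ℝ) (σ : ℝ≥0) (hβ : 1 / 2 < β) (hC : 0 < C) (hσ : 0 < σ)
    (r : (n : ℕ) → Fin n → ℕ) (hr : ∀ n j, 1 ≤ r n j) :
    Deconvolution.AlgebraicRatesAttainable β C (gaussianReal μ (σ ^ 2)) r ↔
      ∃ α γ c δ : ℝ, 0 < α ∧ 0 < γ ∧ 0 < c ∧ 0 < δ ∧
        ∀ n : ℕ, 2 ≤ n →
          c * (n : ℝ) ^ δ ≤ ((Deconvolution.smallVarianceSet σ r n γ α).ncard : ℝ) := by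
  refine ⟨Deconvolution.exists_card_of_algebraicRatesAttainable hβ hC hr, ?_⟩
  rintro ⟨α, γ, c, δ, hα, hγ, hc, hδ, h⟩
  exact Deconvolution.algebraicRatesAttainable_of_card hβ hC hr hα hγ hc hδ h
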